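/- Let $d\ge 1$ and let $X\subset\mathbb R^d$ be a non-empty compact set with $\overline{\operatorname{int}X}=X$ such that $\partial X$ is smooth, or $X$ is convex, or, more generally, $X$ satisfies the cone condition (there are an angle and a size such that every $x\in\partial X$ is the vertex of an open truncated cone of this opening angle and size contained in $\operatorname{int}X$). For a map $\varphi$ put $\|D\varphi\|=\sup_{x\in X}|D\varphi(x)|$. A non-autonomous conformal iterated function system $\Phi$ on $X$ is a sequence of families $\Phi^{(n)}=(\varphi^{(n)}_i:X\to X)_{i\in I^{(n)}}$, $n\ge 1$, with non-empty countable index sets $I^{(n)}$, such that: (open set condition) $\varphi^{(n)}_a(\operatorname{int}X)\cap\varphi^{(n)}_b(\operatorname{int}X)=\emptyset$ for all $n$ and all $a\ne b$ in $I^{(n)}$; (conformality) there is an open connected $V\supset X$ such that every $\varphi^{(n)}_i$ extends to a $C^1$ conformal diffeomorphism of $V$ into $V$; (bounded distortion) there is $K\ge1$ such that $|D\varphi(x)|\le K|D\varphi(y)|$ for all $x,y\in V$ and all compositions $\varphi=\varphi^{(k)}_{\omega_k}\circ\dots\circ\varphi^{(l)}_{\omega_l}$, $k\le l$, $\omega_j\in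 I^{(j)}$; (uniform contraction) there is $\eta<1$ such that for all sufficiently large $m$, $|D\varphi(x)|\le\eta^m$ for all $x\in X$ and all $\varphi=\varphi^{(j)}_{\omega_j}\circ\dots\circ\varphi^{(j+m)}_{\omega_{j+m}}$, $j\ge1$. The system is finite if every $I^{(n)}$ is finite. Let $I^n=I^{(1)}\times\dots\times I^{(n)}$, $\varphi_\omega=\varphi^{(1)}_{\omega_1}\circ\dots\circ\varphi^{(n)}_{\omega_n}$ for $\omega\in I^n$, $J(\Phi)=\bigcap_{n\ge1}\bigcup_{\omega\in I^n}\varphi_\omega(X)$, $Z_n(t)=\sum_{\omega\in I^n}\|D\varphi_\omega\|^t$, and $\underline P(t)=\liminf_{n\to\infty}\frac1n\log Z_n(t)\in[-\infty,\infty]$. The Bowen dimension is $B(\Phi)=\sup\{t\ge0:\underline P(t)>0\}$ (with $\sup\emptyset=0$), and Bowen's formula is said to hold for $\Phi$ if $\operatorname{HD}(J(\Phi))=B(\Phi)$, where $\operatorname{HD}$ is the Hausdorff dimension. **Theorem.** Suppose that $\Phi$ is a finite non-autonomous conformal iterated function system on $X$ of at most exponential growth, $\limsup_{n\to\infty}\frac1n\log\#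 I^{(n)}<\infty$, and that one of the following holds: 1. $\|D\varphi^{(n)}_i\|\to0$ uniformly in $i$ as $n\to\infty$; 2. $\operatorname{HD}(J(\Phi))=0$; 3. $B(\Phi)=d$. Then Bowen's formula holds for $\Phi$, i.e. $\operatorname{HD}(J(\Phi))=B(\Phi)$. On the other hand, let $(\alpha_n)_{n\ge1}$ be an arbitrary sequence of positive integers with $\lim_{n\to\infty}\frac1n\log\alpha_n=\infty$. Then there is a finite non-autonomous conformal iterated function system $\Phi$ on $X$ with $\#I^{(n)}\le\alpha_n$ for all $n$ for which 1, 2 and 3 all hold, so that Bowen's formula fails for $\Phi$. Moreover, $\Phi$ can be chosen such that, for some $\eta<1$, $|D\varphi^{(n)}_i(x)|\le\eta$ for all $n\ge1$, $i\in I^{(n)}$ and $x\in X$. -/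

import Mathlib

open Set Filter Topology
open scoped ENNReal NNReal ContDiff

noncomputable section

/-- The boundary of `X` is smooth: near each of its boundary points, `X` is a sublevel set of a
`C^∞` function without critical points. -/
def HasSmoothBoundary {d : ℕ} (X : Set (EuclideanSpace ℝ (Fin d))) : Prop :=
  ∀ x ∈ frontier X, ∃ U : Set (EuclideanSpace ℝ (Fin d)), ∃ g : EuclideanSpace ℝ (Fin d) → ℝ,
    IsOpen U ∧ x ∈ U ∧ ContDiffOn ℝ ∞ g U ∧ (∀ y ∈ U, fderiv ℝ g y ≠ 0) ∧
      X ∩ U = {y ∈ U | g y ≤ 0}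

/-- The cone condition: every boundary point of `X` is the vertex of an open (truncated) cone
contained in the interior of `X`, where the opening angle (`κ` is the cosine of half of it) and
the size `l` of the cone do not depend on the point. -/
def HasConeCondition {d : ℕ} (X : Set (EuclideanSpace ℝ (Fin d))) : Prop :=
  ∃ κ l : ℝ, 0 < κ ∧ κ < 1 ∧ 0 < l ∧ ∀ x ∈ frontier X, ∃ u : EuclideanSpace ℝ (Fin d), ‖u‖ = 1 ∧
    ∀ y, ‖y - x‖ < l → κ * ‖y - x‖ < inner ℝ u (y - x) → y ∈ interior X

/-- The phase spaces: non-empty compact sets that are the closure of their interior, and that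
have a smooth boundary, or are convex, or, more generally, satisfy the cone condition. -/
structure IsPhaseSpace {d : ℕ} (X : Set (EuclideanSpace ℝ (Fin d))) : Prop where
  nonempty : X.Nonempty
  isCompact : IsCompact X
  closure_interior : closure (interior X) = X
  geometry : HasSmoothBoundary X ∨ Convex ℝ X ∨ HasConeCondition X

/-- The norm `‖Dφ‖ = sup {|Dφ(x)| : x ∈ X}`. For a conformal map of `ℝ^d`, `d ≥ 1`, the operator
norm of the derivative at a point is its scaling factor. -/
def derivNorm {d : ℕ} (X : Set (EuclideanSpace ℝ (Fin d)))
    (f : EuclideanSpace ℝ (Fin d) → EuclideanSpace ℝ (Fin d)) : ℝ≥0∞ :=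
  ⨆ x ∈ X, ‖fderiv ℝ f x‖ₑ

/-- Words `ω_k ω_{k+1} … ω_{k+l-1}` of `l` symbols that start at level `k`. -/
abbrev LevelWord (I : ℕ → Type) (k l : ℕ) : Type := ∀ i : Fin l, I (k + i)

/-- The composition `φ_{ω_k} ∘ φ_{ω_{k+1}} ∘ … ∘ φ_{ω_{k+l-1}}` associated with a word. -/
def wordMap {E : Type} {I : ℕ → Type} (φ : ∀ n, I n → E → E) (k : ℕ) :
    ∀ l : ℕ, LevelWord I k l → E → E
  | 0, _ => id
  | l + 1, w => wordMap φ k l (fun i => w i.castSucc) ∘ φ (k + l) (w (Fin.last l))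

/-- A non-autonomous conformal iterated function system on `X`. Levels are counted from `0`:
`I n` and `map n` are what is usually written `I^(n+1)` and `Φ^(n+1)`. A map `X → X` of the system
is given together with its conformal extension to `V`, so `map n i` is a total function whose
values outside `V` play no role. -/
structure NCIFS {d : ℕ} (X : Set (EuclideanSpace ℝ (Fin d))) where
  /-- The index sets. -/
  I : ℕ → Type
  countable_I : ∀ n, Countable (I n)
  nonempty_I : ∀ n, Nonempty (I n)
  /-- The maps. -/
  map : ∀ n, I n → EuclideanSpace ℝ (Fin d) → EuclideanSpace ℝ (Fin d)
  mapsTo : ∀ n i, MapsTo (map n i) X X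
  /-- Open set condition. -/
  openSet : ∀ n (a b : I n), a ≠ b →
    Disjoint (map n a '' interior X) (map n b '' interior X)
  /-- Conformality: the neighbourhood of `X` on which all the maps are conformal. -/
  V : Set (EuclideanSpace ℝ (Fin d))
  isOpen_V : IsOpen V
  isConnected_V : IsConnected V
  subset_V : X ⊆ V
  mapsTo_V : ∀ n i, MapsTo (map n i) V V
  injOn_V : ∀ n i, InjOn (map n i) V
  contDiffOn_V : ∀ n i, ContDiffOn ℝ 1 (map n i) V
  conformalAt_V : ∀ n i, ∀ x ∈ V, ConformalAt (map n i) x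
  /-- Bounded distortion. -/
  distortion : ∃ K : ℝ, 1 ≤ K ∧ ∀ (k l : ℕ) (w : LevelWord I k l), ∀ x ∈ V, ∀ y ∈ V,
    ‖fderiv ℝ (wordMap map k l w) x‖ ≤ K * ‖fderiv ℝ (wordMap map k l w) y‖
  /-- Uniform contraction. -/
  contraction : ∃ η : ℝ, 0 < η ∧ η < 1 ∧ ∃ M : ℕ, ∀ m ≥ M, ∀ (k : ℕ) (w : LevelWord I k (m + 1)),
    ∀ x ∈ X, ‖fderiv ℝ (wordMap map k (m + 1) w) x‖ ≤ η ^ m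

namespace NCIFS

variable {d : ℕ} {X : Set (EuclideanSpace ℝ (Fin d))}

/-- The limit set `J(Φ) = ⋂_{n ≥ 1} ⋃_{ω ∈ I^n} φ_ω(X)`. -/
def limitSet (Φ : NCIFS X) : Set (EuclideanSpace ℝ (Fin d)) :=
  ⋂ n : ℕ, ⋂ _ : 1 ≤ n, ⋃ w : LevelWord Φ.I 0 n, wordMap Φ.map 0 n w '' X

/-- `Z_n(t)`, the sum of `‖Dφ_ω‖^t` over the initial words `ω` of length `n`. -/
def Z (Φ : NCIFS X) (n : ℕ) (t : ℝ) : ℝ≥0∞ :=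
  ∑' w : LevelWord Φ.I 0 n, derivNorm X (wordMap Φ.map 0 n w) ^ t

/-- The lower pressure `liminf (1/n) log Z_n(t)`, a value in `[-∞, ∞]`. -/
def lowerPressure (Φ : NCIFS X) (t : ℝ) : EReal :=
  liminf (fun n : ℕ => ENNReal.log (Φ.Z n t) / (n : EReal)) atTop

/-- The Bowen dimension `B(Φ)`, the supremum of all `t ≥ 0` at which the lower pressure is
positive (and `0` if there are none). -/
def bowenDim (Φ : NCIFS X) : ℝ≥0∞ :=
  ⨆ (t : ℝ≥0) (_ : 0 < Φ.lowerPressure t), (t : ℝ≥0∞)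

/-- Bowen's formula: the Hausdorff dimension of the limit set is the Bowen dimension. -/
def BowenFormula (Φ : NCIFS X) : Prop := dimH Φ.limitSet = Φ.bowenDim

/-- `‖Dφ_i^(n)‖ → 0` uniformly in `i` as `n → ∞`. -/
def SmallPieces (Φ : NCIFS X) : Prop :=
  Tendsto (fun n => ⨆ i : Φ.I n, derivNorm X (Φ.map n i)) atTop (𝓝 0)

/-- The stronger form of uniform contraction: one constant below `1` bounds the derivatives of
all the individual maps of the system. -/
def StronglyContracting (Φ : NCIFS X) : Prop :=
  ∃ η : ℝ, η < 1 ∧ ∀ n (i : Φ.I n), ∀ x ∈ X, ‖fderiv ℝ (Φ.map n i) x‖ ≤ η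

end NCIFS

end

/-! The inequality `dimH_limitSet_le_bowenDim` needs no growth condition: at an exponent above the
Bowen dimension, the images of `X` under the words of length n form covers of the limit set with
bounded Hausdorff sums for infinitely many n.

For the reverse inequality, give each word w of length n the mass wt(w)^t / Z_n(t), where the lower
pressure at t is positive. Given a ball of radius r ≤ 1, sort the words that meet it by the length k
+ 1 of the first prefix whose weight is below r. The prefixes of length k have weight at least r,
and a volume packing argument leaves boundedly many of them, so their share of the mass is O(1/Z_k).
The prefixes of length k + 1 number O(N_k), with N_k the size of the alphabet, and the d-th powers
of their weights sum to O(r^d); interpolation bounds their share by O(N_k^(1-t/d) r^t / Z_{k+1}).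
This is `exists_sum_stops_le`. If the smaller bound is at most C q^k r^s with q < 1, then summation
over k and a mass distribution principle give dimension at least s (`le_dimH_limitSet`).

Let N_k ≤ C exp(Ak). If the pieces are small, weights decay superexponentially, so at any exponent
below t the partition function outgrows N_k. In general, a weighted geometric mean of the two bounds
gives positive dimension as soon as B > 0; hence dimension 0 forces B = 0. If B = d, let t tend to
d: since r is O(η^k), the factor N_k^(1-t/d) costs only a small power of r.

For the counterexample, level n consists of 2^(d h_n) homotheties of ratio c₀ 2^(-l_n), arranged in
a grid of diameter O(2^(h_n - l_n)). If h_n / l_n → 1 and l_n → ∞, the pressure is positive at every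
t < d. If moreover l_n - h_n is, infinitely often, much larger than h_0 + … + h_{n-1}, then covering
each whole grid by one set takes so few sets, of such small diameter, that the dimension is 0.
Superexponential alphabets leave room for both (`exists_jump_sequences`). -/

/-! ### Fatness of the interior of a phase space -/

noncomputable section

/-- Around each point of `X ∩ U`, at all small scales, the interior of `X` contains a ball of
comparable size. -/
def FatInteriorOn {E : Type*} [NormedAddCommGroup E] (X U : Set E) : Prop :=
  ∃ c s₀ : ℝ, 0 < c ∧ 0 < s₀ ∧ ∀ z ∈ X ∩ U, ∀ s, 0 < s → s ≤ s₀ →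
    ∃ p, Metric.ball p (c * s) ⊆ interior X ∩ Metric.ball z s

section FatInterior

variable {E : Type*} [NormedAddCommGroup E]

/-- Both constants can be shrunk, so a finite union of good sets is good; compactness does the rest.
-/
theorem fatInteriorOn_of_local {X : Set E} (hX : IsCompact X)
    (h : ∀ x ∈ X, ∃ U ∈ 𝓝 x, FatInteriorOn X U) : FatInteriorOn X X := by
  refine hX.induction_on (p := fun U => FatInteriorOn X U) ?_ ?_ ?_ ?_
  · exact ⟨1, 1, one_pos, one_pos, fun z hz => absurd hz.2 (notMem_empty z)⟩
  · rintro S T hST ⟨c, s₀, hc, hs, H⟩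
    exact ⟨c, s₀, hc, hs, fun z hz => H z ⟨hz.1, hST hz.2⟩⟩
  · rintro S T ⟨c, s₀, hc, hs, H⟩ ⟨c', s₀', hc', hs', H'⟩
    refine ⟨min c c', min s₀ s₀', lt_min hc hc', lt_min hs hs', ?_⟩
    rintro z ⟨hzX, hz | hz⟩ s hs0 hss
    · obtain ⟨p, hp⟩ := H z ⟨hzX, hz⟩ s hs0 (hss.trans (min_le_left _ _))
      exact ⟨p, (Metric.ball_subset_ball (by gcongr; exact min_le_left _ _)).trans hp⟩
    · obtain ⟨p, hp⟩ := H' z ⟨hzX, hz⟩ s hs0 (hss.trans (min_le_right _ _))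
      exact ⟨p, (Metric.ball_subset_ball (by gcongr; exact min_le_right _ _)).trans hp⟩
  · intro x hx
    obtain ⟨U, hU, H⟩ := h x hx
    exact ⟨U, mem_nhdsWithin_of_mem_nhds hU, H⟩

theorem exists_fatInteriorOn_of_mem_interior {X : Set E} {x : E} (hx : x ∈ interior X) :
    ∃ U ∈ 𝓝 x, FatInteriorOn X U := by
  obtain ⟨δ, hδ, hb⟩ := Metric.isOpen_iff.1 isOpen_interior x hx
  refine ⟨Metric.ball x (δ / 2), Metric.ball_mem_nhds x (by positivity), 1, δ / 2, one_pos,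
    by positivity, fun z hz s hs hsδ => ⟨z, ?_⟩⟩
  rw [one_mul]
  refine subset_inter (fun y hy => hb ?_) Subset.rfl
  have h1 := hz.2
  rw [Metric.mem_ball] at *
  linarith [dist_triangle y z x]

variable [NormedSpace ℝ E]

/-- Moving from z by (s/b)u, where A u = -1, lowers the linear part of g by s/b. The linearization
error and the displacement inside the small ball cost at most a quarter of this each, so g stays
nonpositive. Strict differentiability makes the estimate uniform in z near x. -/
theorem exists_fatInteriorOn_of_sublevel {X U : Set E} {x : E} {g : E → ℝ} {A : E →L[ℝ] ℝ}
    (hU : IsOpen U) (hxU : x ∈ U) (hg : HasStrictFDerivAt g A x) (hA : A ≠ 0)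
    (hX : X ∩ U = {y ∈ U | g y ≤ 0}) : ∃ W ∈ 𝓝 x, FatInteriorOn X W := by
  obtain ⟨v, hv⟩ : ∃ v, A v ≠ 0 := by
    by_contra! h
    exact hA (ContinuousLinearMap.ext h)
  set u : E := (-(A v)⁻¹) • v with hu
  have hAu : A u = -1 := by simp [hu, hv]
  set b : ℝ := ‖u‖ + 1 with hb
  have hb0 : 0 < b := by positivity
  set ε : ℝ := min 1 (1 / (4 * (‖A‖ + 1))) with hε
  have hε0 : 0 < ε := by positivity
  have hε1 : ε ≤ 1 := min_le_left _ _
  have hεA : ‖A‖ * ε ≤ 1 / 4 := by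
    have h : ε ≤ 1 / (4 * (‖A‖ + 1)) := min_le_right _ _
    rw [le_div_iff₀ (by positivity)] at h
    nlinarith
  have hlo := hg.isLittleO.def (c := 1 / (4 * b)) (by positivity)
  obtain ⟨δ, hδ, hball⟩ := Metric.eventually_nhds_iff_ball.1
    (hlo.and ((hU.prod hU).mem_nhds (mk_mem_prod hxU hxU)))
  have key : ∀ y ∈ Metric.ball x δ, ∀ z ∈ Metric.ball x δ, y ∈ U ∧ z ∈ U ∧
      ‖g y - g z - A (y - z)‖ ≤ 1 / (4 * b) * ‖y - z‖ := by
    intro y hy z hz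
    have h := hball (y, z) (by
      rw [Metric.mem_ball] at *
      exact max_lt hy hz)
    exact ⟨h.2.1, h.2.2, h.1⟩
  refine ⟨Metric.ball x (δ / 2), Metric.ball_mem_nhds x (by positivity), ε / b, δ / 2,
    by positivity, by positivity, fun z hz s hs hsδ => ⟨z + (s / b) • u, ?_⟩⟩
  have hzδ : z ∈ Metric.ball x δ := Metric.ball_subset_ball (by linarith) hz.2
  have hτ : 0 < s / b := by positivity
  have hsb : s = s / b * b := by field_simp
  have hsub : Metric.ball (z + (s / b) • u) (ε / b * s) ⊆ X ∩ Metric.ball z s := by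
    intro y hy
    set e := y - (z + (s / b) • u) with he
    have hyz : y - z = (s / b) • u + e := by rw [he]; abel
    have hen : ‖e‖ < ε * (s / b) := by
      have h : ‖e‖ < ε / b * s := by rwa [Metric.mem_ball, dist_eq_norm] at hy
      calc ‖e‖ < ε / b * s := h
        _ = ε * (s / b) := by ring
    have hnorm : ‖y - z‖ < s := by
      rw [hyz]
      have h1 : ‖(s / b) • u‖ = s / b * ‖u‖ := by rw [norm_smul, Real.norm_of_nonneg hτ.le]
      have h2 : ε * (s / b) ≤ s / b := by nlinarith
      have h3 : s = s / b * ‖u‖ + s / b := by rw [hsb, hb]; field_simp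
      linarith [norm_add_le ((s / b) • u) e]
    have hyδ : y ∈ Metric.ball x δ := by
      have h1 := hz.2
      rw [Metric.mem_ball] at *
      rw [← dist_eq_norm] at hnorm
      linarith [dist_triangle y z x]
    obtain ⟨hyU, hzU, hk⟩ := key y hyδ z hzδ
    have hgz : g z ≤ 0 := by
      have h : z ∈ X ∩ U := ⟨hz.1, hzU⟩
      rw [hX] at h
      exact h.2
    have hAe : |A e| ≤ 1 / 4 * (s / b) := by
      have h1 := A.le_opNorm e
      rw [Real.norm_eq_abs] at h1
      have h2 : ‖A‖ * ‖e‖ ≤ ‖A‖ * (ε * (s / b)) := by gcongr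
      have h3 : ‖A‖ * ε * (s / b) ≤ 1 / 4 * (s / b) := by gcongr
      nlinarith
    have hAyz : A (y - z) = -(s / b) + A e := by
      rw [hyz, map_add, map_smul, hAu]; simp
    have hk2 : 1 / (4 * b) * ‖y - z‖ ≤ 1 / 4 * (s / b) := by
      calc 1 / (4 * b) * ‖y - z‖ ≤ 1 / (4 * b) * s := by gcongr
        _ = 1 / 4 * (s / b) := by field_simp
    have hgy : g y ≤ 0 := by
      have h1 := (abs_le.1 ((Real.norm_eq_abs _) ▸ hk)).2
      have h2 := (abs_le.1 hAe).2
      rw [hAyz] at h1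
      linarith
    refine ⟨?_, by rwa [Metric.mem_ball, dist_eq_norm]⟩
    have h : y ∈ {y ∈ U | g y ≤ 0} := ⟨hyU, hgy⟩
    rw [← hX] at h
    exact h.1
  exact subset_inter (interior_maximal (hsub.trans inter_subset_left) Metric.isOpen_ball)
    (hsub.trans inter_subset_right)

/-- Shrink one fixed interior ball towards z, with ratio proportional to s; by convexity it stays in
`X`. -/
theorem Convex.fatInteriorOn {X : Set E} (hX : Convex ℝ X) (hc : Bornology.IsBounded X)
    (hne : (interior X).Nonempty) : FatInteriorOn X X := by
  obtain ⟨p₀, hp₀⟩ := hne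
  obtain ⟨ρ, hρ, hb⟩ := Metric.isOpen_iff.1 isOpen_interior p₀ hp₀
  obtain ⟨D, hD⟩ := hc.subset_closedBall p₀
  have hD0 : 0 ≤ D := by
    have h := hD (interior_subset hp₀)
    rwa [Metric.mem_closedBall, dist_self] at h
  refine ⟨ρ / (D + ρ), D + ρ, by positivity, by positivity, fun z hz s hs hs1 => ?_⟩
  set l := s / (D + ρ) with hl
  have hl0 : 0 < l := by positivity
  have hl1 : l ≤ 1 := (div_le_one (by positivity)).2 hs1
  refine ⟨z + l • (p₀ - z), ?_⟩
  have hr : ρ / (D + ρ) * s = l * ρ := by rw [hl]; ring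
  rw [hr]
  have hsub : Metric.ball (z + l • (p₀ - z)) (l * ρ) ⊆ X ∩ Metric.ball z s := by
    intro y hy
    set q := z + l⁻¹ • (y - z) with hq
    have hy' : y = z + l • (q - z) := by
      rw [hq, add_sub_cancel_left, smul_smul, mul_inv_cancel₀ hl0.ne', one_smul]; abel
    have hqp : dist q p₀ < ρ := by
      rw [Metric.mem_ball, dist_eq_norm] at hy
      have : y - (z + l • (p₀ - z)) = l • (q - p₀) := by
        rw [hy']; module
      rw [this, norm_smul, Real.norm_of_nonneg hl0.le] at hy
      rw [dist_eq_norm]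
      exact lt_of_mul_lt_mul_left hy hl0.le
    have hqX : q ∈ X := interior_subset (hb hqp)
    refine ⟨?_, ?_⟩
    · rw [hy']
      have h := hX hz.1 hqX (sub_nonneg.2 hl1) hl0.le (by ring)
      convert h using 1
      module
    · rw [Metric.mem_ball, dist_eq_norm, hy', add_sub_cancel_left, norm_smul,
        Real.norm_of_nonneg hl0.le, ← dist_eq_norm]
      have h1 : dist z p₀ ≤ D := hD hz.1
      have h2 : dist q z < D + ρ := by
        linarith [dist_triangle q p₀ z, dist_comm z p₀]
      calc l * dist q z < l * (D + ρ) := by gcongr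
        _ = s := by rw [hl]; field_simp
  exact subset_inter (interior_maximal (hsub.trans inter_subset_left) Metric.isOpen_ball)
    (hsub.trans inter_subset_right)

end FatInterior

variable {d : ℕ} {X : Set (EuclideanSpace ℝ (Fin d))}

theorem HasConeCondition.fatInteriorOn (h : HasConeCondition X) : FatInteriorOn X X := by
  obtain ⟨κ, l, hκ, hκ1, hl, H⟩ := h
  set ε := (1 - κ) / 4 with hε
  have hε0 : 0 < ε := by rw [hε]; linarith
  have hε1 : ε ≤ 1 / 4 := by rw [hε]; linarith
  refine ⟨ε / 8, l, by positivity, hl, fun z hz s hs hsl => ?_⟩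
  -- Either z is deep inside `X`, or, the ball being connected, some boundary point x lies within
  -- s/2 of z. In the second case the cone at x contains a ball around the point of its axis at
  -- distance s/8 from x.
  by_cases hball : Metric.ball z (s / 2) ⊆ interior X
  · refine ⟨z, subset_inter ((Metric.ball_subset_ball ?_).trans hball)
      (Metric.ball_subset_ball ?_)⟩ <;> nlinarith
  · obtain ⟨x, hx, hxz⟩ : ∃ x ∈ frontier X, dist x z ≤ s / 2 := by
      by_cases hzi : z ∈ interior X
      · have hpre : IsPreconnected (Metric.ball z (s / 2)) :=
          (convex_ball z (s / 2)).isPreconnected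
        have hmeet : (Metric.ball z (s / 2) ∩ frontier (interior X)).Nonempty := by
          by_contra hno
          rw [not_nonempty_iff_eq_empty] at hno
          apply hball
          refine hpre.subset_of_closure_inter_subset isOpen_interior
            ⟨z, Metric.mem_ball_self (by positivity), hzi⟩ ?_
          rintro y ⟨hy1, hy2⟩
          by_contra hyn
          have : y ∈ Metric.ball z (s / 2) ∩ frontier (interior X) :=
            ⟨hy2, hy1, by rwa [interior_interior]⟩
          rw [hno] at this
          exact this
        obtain ⟨x, hx1, hx2⟩ := hmeet
        exact ⟨x, frontier_interior_subset hx2, (Metric.mem_ball.1 hx1).le⟩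
      · exact ⟨z, ⟨subset_closure hz.1, hzi⟩, by rw [dist_self]; positivity⟩
    obtain ⟨u, hu, hcone⟩ := H x hx
    refine ⟨x + (s / 8) • u, fun y hy => ?_⟩
    set e := y - (x + (s / 8) • u) with he
    have hyx : y - x = (s / 8) • u + e := by rw [he]; abel
    have hen : ‖e‖ < ε * (s / 8) := by
      rw [Metric.mem_ball, dist_eq_norm] at hy
      calc ‖e‖ < ε / 8 * s := hy
        _ = _ := by ring
    have hn : ‖y - x‖ ≤ s / 8 + ‖e‖ := by
      rw [hyx]
      refine (norm_add_le _ _).trans_eq ?_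
      rw [norm_smul, hu, Real.norm_of_nonneg (by positivity), mul_one]
    have hi : s / 8 - ‖e‖ ≤ inner ℝ u (y - x) := by
      rw [hyx, inner_add_right, real_inner_smul_right, real_inner_self_eq_norm_sq, hu]
      have h := neg_le_of_abs_le (abs_real_inner_le_norm u e)
      rw [hu] at h
      linarith
    have hes : ‖e‖ < s / 8 := by nlinarith
    refine ⟨hcone y (by linarith) ?_, ?_⟩
    · have h1 : κ * ‖y - x‖ ≤ κ * (s / 8 + ‖e‖) := by gcongr
      have h2 : κ * ‖e‖ ≤ ‖e‖ := by nlinarith [norm_nonneg e]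
      have h3 : ε * (s / 8) = (1 - κ) * (s / 32) := by rw [hε]; ring
      nlinarith
    · rw [Metric.mem_ball]
      rw [← dist_eq_norm] at hn
      linarith [dist_triangle y x z]

theorem IsPhaseSpace.interior_nonempty (hX : IsPhaseSpace X) : (interior X).Nonempty := by
  rw [← closure_nonempty_iff, hX.closure_interior]
  exact hX.nonempty

theorem IsPhaseSpace.fatInteriorOn (hX : IsPhaseSpace X) : FatInteriorOn X X := by
  rcases hX.geometry with h | h | h
  · refine fatInteriorOn_of_local hX.isCompact fun x hx => ?_
    by_cases hxi : x ∈ interior X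
    · exact exists_fatInteriorOn_of_mem_interior hxi
    · obtain ⟨U, g, hU, hxU, hg, hg', hXU⟩ := h x ⟨subset_closure hx, hxi⟩
      have hs := (hg.contDiffAt (hU.mem_nhds hxU)).hasStrictFDerivAt (by simp)
      exact exists_fatInteriorOn_of_sublevel hU hxU hs (hg' x hxU) hXU
  · exact h.fatInteriorOn hX.isCompact.isBounded hX.interior_nonempty
  · exact h.fatInteriorOn

end

/-! ### Conformal derivatives and compositions along words -/

noncomputable section

open MeasureTheory

theorem IsConformalMap.norm_comp {d : ℕ} [NeZero d]
    {A B : EuclideanSpace ℝ (Fin d) →L[ℝ] EuclideanSpace ℝ (Fin d)}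
    (hA : IsConformalMap A) : ‖A.comp B‖ = ‖A‖ * ‖B‖ := by
  obtain ⟨c, hc, li, rfl⟩ := hA
  have h1 : ‖(c • li.toContinuousLinearMap :
      EuclideanSpace ℝ (Fin d) →L[ℝ] EuclideanSpace ℝ (Fin d))‖ = ‖c‖ := by
    rw [norm_smul, li.norm_toContinuousLinearMap, mul_one]
  rw [h1, ContinuousLinearMap.smul_comp, norm_smul, li.norm_toContinuousLinearMap_comp]

/-- The image of the unit ball is a ball whose radius is the scaling factor; compare volumes. -/
theorem IsConformalMap.abs_det_eq {d : ℕ} [NeZero d]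
    {A : EuclideanSpace ℝ (Fin d) →L[ℝ] EuclideanSpace ℝ (Fin d)}
    (hA : IsConformalMap A) : |A.det| = ‖A‖ ^ d := by
  obtain ⟨c, hc, li, rfl⟩ := hA
  have h1 : ‖(c • li.toContinuousLinearMap :
      EuclideanSpace ℝ (Fin d) →L[ℝ] EuclideanSpace ℝ (Fin d))‖ = ‖c‖ := by
    rw [norm_smul, li.norm_toContinuousLinearMap, mul_one]
  have himg : (c • li.toContinuousLinearMap :
      EuclideanSpace ℝ (Fin d) →L[ℝ] EuclideanSpace ℝ (Fin d)) '' Metric.ball 0 1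
      = Metric.ball 0 ‖c‖ := by
    have h2 : ⇑(c • li.toContinuousLinearMap :
      EuclideanSpace ℝ (Fin d) →L[ℝ] EuclideanSpace ℝ (Fin d)) =
        (fun x => c • x) ∘ (li.toLinearIsometryEquiv rfl) := by
      ext x; simp
    rw [h2, image_comp, LinearIsometryEquiv.image_ball, map_zero, image_smul,
      _root_.smul_ball hc, smul_zero, mul_one]
  have h3 := Measure.addHaar_image_continuousLinearMap
    (volume : Measure (EuclideanSpace ℝ (Fin d))) (c • li.toContinuousLinearMap)
    (Metric.ball 0 1)
  rw [himg, Measure.addHaar_ball _ _ (norm_nonneg c)] at h3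
  have h4 := (ENNReal.mul_left_inj (Metric.measure_ball_pos volume _ one_pos).ne'
    measure_ball_lt_top.ne).1 h3
  rw [ENNReal.ofReal_eq_ofReal_iff (by positivity) (abs_nonneg _)] at h4
  rw [h1, ← h4, finrank_euclideanSpace_fin]

/-- On a compact subset of a connected open set, differentiable functions are Lipschitz at large
scale, with respect to the supremum of their derivative. -/
theorem IsCompact.exists_dist_image_le {E : Type*} [NormedAddCommGroup E] [NormedSpace ℝ E]
    {V X : Set E} (hVo : IsOpen V) (hVc : IsConnected V) (hX : IsCompact X) (hXV : X ⊆ V) :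
    ∃ C : ℝ, 0 < C ∧ ∀ (f : E → E) (M : ℝ), (∀ x ∈ V, DifferentiableAt ℝ f x) →
      (∀ x ∈ V, ‖fderiv ℝ f x‖ ≤ M) → ∀ x ∈ X, ∀ y ∈ X, dist (f x) (f y) ≤ C * M := by
  let P : ℝ → E → E → Prop := fun C x y => ∀ (f : E → E) (M : ℝ),
    (∀ x ∈ V, DifferentiableAt ℝ f x) →
      (∀ x ∈ V, ‖fderiv ℝ f x‖ ≤ M) → dist (f x) (f y) ≤ C * M
  have hloc : ∀ x ∈ V, ∃ δ > 0, Metric.ball x δ ⊆ V ∧ ∀ y ∈ Metric.ball x δ, P δ x y := by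
    intro x hx
    obtain ⟨δ, hδ, hb⟩ := Metric.isOpen_iff.1 hVo x hx
    refine ⟨δ, hδ, hb, fun y hy f M hf hM => ?_⟩
    have h := (convex_ball x δ).norm_image_sub_le_of_norm_fderiv_le
      (fun z hz => hf z (hb hz)) (fun z hz => hM z (hb hz)) hy (Metric.mem_ball_self hδ)
    rw [← dist_eq_norm, ← dist_eq_norm] at h
    have hM0 : 0 ≤ M := (norm_nonneg _).trans (hM x hx)
    rw [Metric.mem_ball, dist_comm] at hy
    nlinarith
  obtain ⟨x₀, hx₀⟩ := hVc.nonempty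
  -- Having some constant that serves all f and M is a symmetric and transitive relation between
  -- points, and it holds locally; connectedness of `V` spreads it to all pairs.
  have hpair : ∀ y ∈ V, ∃ C, P C x₀ y := by
    intro y hy
    refine hVc.isPreconnected.induction₂ (fun x y => ∃ C, P C x y) ?_ ?_ ?_ hx₀ hy
    · intro x hx
      obtain ⟨δ, hδ, -, h⟩ := hloc x hx
      exact mem_nhdsWithin_of_mem_nhds
        (mem_of_superset (Metric.ball_mem_nhds x hδ) fun y hy => ⟨δ, h y hy⟩)
    · rintro x y z - - - ⟨C, h⟩ ⟨C', h'⟩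
      refine ⟨C + C', fun f M hf hM => ?_⟩
      linarith [dist_triangle (f x) (f y) (f z), h f M hf hM, h' f M hf hM]
    · rintro x y - - ⟨C, h⟩
      exact ⟨C, fun f M hf hM => by rw [dist_comm]; exact h f M hf hM⟩
  have hmono : ∀ {C C' : ℝ} {x y : E}, C ≤ C' → P C x y → P C' x y := by
    intro C C' x y hC h f M hf hM
    have hM0 : 0 ≤ M := (norm_nonneg _).trans (hM x₀ hx₀)
    exact (h f M hf hM).trans (by gcongr)
  obtain ⟨C, hC⟩ : ∃ C, ∀ y ∈ X, P C x₀ y := by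
    refine hX.induction_on (p := fun S => ∃ C, ∀ y ∈ S, P C x₀ y) ⟨0, by simp⟩ ?_ ?_ ?_
    · rintro S T hST ⟨C, h⟩
      exact ⟨C, fun y hy => h y (hST hy)⟩
    · rintro S T ⟨C, h⟩ ⟨C', h'⟩
      refine ⟨max C C', ?_⟩
      rintro y (hy | hy)
      · exact hmono (le_max_left _ _) (h y hy)
      · exact hmono (le_max_right _ _) (h' y hy)
    · intro x hx
      obtain ⟨δ, hδ, -, h⟩ := hloc x (hXV hx)
      obtain ⟨C, hC⟩ := hpair x (hXV hx)
      refine ⟨Metric.ball x δ, mem_nhdsWithin_of_mem_nhds (Metric.ball_mem_nhds x hδ),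
        C + δ, fun y hy f M hf hM => ?_⟩
      linarith [dist_triangle (f x₀) (f x) (f y), hC f M hf hM, h y hy f M hf hM]
  refine ⟨2 * max C 1, by positivity, fun f M hf hM x hx y hy => ?_⟩
  have h1 := hmono (le_max_left C 1) (hC x hx) f M hf hM
  have h2 := hmono (le_max_left C 1) (hC y hy) f M hf hM
  linarith [dist_triangle_left (f x) (f y) (f x₀)]

namespace NCIFS

variable {d : ℕ} {X : Set (EuclideanSpace ℝ (Fin d))} (Φ : NCIFS X)

/-- The initial words of length `n`. -/
abbrev Word (n : ℕ) : Type := LevelWord Φ.I 0 n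

/-- The composition along an initial word. -/
abbrev word (n : ℕ) (w : Φ.Word n) : EuclideanSpace ℝ (Fin d) → EuclideanSpace ℝ (Fin d) :=
  wordMap Φ.map 0 n w

variable {Φ}

/-- The word without its last symbol. -/
abbrev Word.init {n : ℕ} (w : Φ.Word (n + 1)) : Φ.Word n := fun i => w i.castSucc

theorem word_succ (n : ℕ) (w : Φ.Word (n + 1)) :
    Φ.word (n + 1) w = Φ.word n w.init ∘ Φ.map (0 + n) (w (Fin.last n)) := rfl

theorem word_mapsTo (n : ℕ) (w : Φ.Word n) : MapsTo (Φ.word n w) X X := by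
  induction n with
  | zero => exact mapsTo_id X
  | succ n ih => exact (ih w.init).comp (Φ.mapsTo _ _)

theorem word_injOn (n : ℕ) (w : Φ.Word n) : InjOn (Φ.word n w) Φ.V := by
  induction n with
  | zero => exact injOn_id _
  | succ n ih => exact (ih w.init).comp (Φ.injOn_V _ _) (Φ.mapsTo_V _ _)

theorem word_conformalAt (n : ℕ) (w : Φ.Word n) {x : EuclideanSpace ℝ (Fin d)} (hx : x ∈ Φ.V) :
    ConformalAt (Φ.word n w) x := by
  induction n generalizing x with
  | zero => exact conformalAt_id x
  | succ n ih =>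
    exact (ih w.init (Φ.mapsTo_V _ _ hx)).comp x (Φ.conformalAt_V _ _ x hx)

theorem word_isConformalMap (n : ℕ) (w : Φ.Word n) {x : EuclideanSpace ℝ (Fin d)}
    (hx : x ∈ Φ.V) : IsConformalMap (fderiv ℝ (Φ.word n w) x) :=
  conformalAt_iff_isConformalMap_fderiv.1 (word_conformalAt n w hx)

theorem norm_fderiv_word_succ [NeZero d] (n : ℕ) (w : Φ.Word (n + 1))
    {x : EuclideanSpace ℝ (Fin d)} (hx : x ∈ Φ.V) :
    ‖fderiv ℝ (Φ.word (n + 1) w) x‖ =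
      ‖fderiv ℝ (Φ.word n w.init) (Φ.map (0 + n) (w (Fin.last n)) x)‖ *
        ‖fderiv ℝ (Φ.map (0 + n) (w (Fin.last n))) x‖ := by
  have hy := Φ.mapsTo_V (0 + n) (w (Fin.last n)) hx
  rw [word_succ, fderiv_comp x (word_conformalAt n w.init hy).differentiableAt
    (Φ.conformalAt_V _ _ x hx).differentiableAt, (word_isConformalMap n _ hy).norm_comp]

theorem norm_fderiv_word_pos [NeZero d] (n : ℕ) (w : Φ.Word n)
    {x : EuclideanSpace ℝ (Fin d)} (hx : x ∈ Φ.V) : 0 < ‖fderiv ℝ (Φ.word n w) x‖ :=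
  norm_pos_iff.2 (word_isConformalMap n w hx).ne_zero

/-- The image is open: an injective derivative is onto in finite dimension, so the inverse function
theorem applies. -/
theorem map_image_interior_subset (n : ℕ) (i : Φ.I n) :
    Φ.map n i '' interior X ⊆ interior X := by
  refine interior_maximal ((Φ.mapsTo n i).mono_left interior_subset).image_subset ?_
  rw [isOpen_iff_mem_nhds]
  rintro _ ⟨x, hx, rfl⟩
  have hxV : x ∈ Φ.V := Φ.subset_V (interior_subset hx)
  have hs := ((Φ.contDiffOn_V n i).contDiffAt (Φ.isOpen_V.mem_nhds hxV)).hasStrictFDerivAt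
    one_ne_zero
  have hc := conformalAt_iff_isConformalMap_fderiv.1 (Φ.conformalAt_V n i x hxV)
  rw [← hs.map_nhds_eq_of_surj
    (LinearMap.range_eq_top.2 (LinearMap.injective_iff_surjective.1 hc.injective))]
  exact image_mem_map (isOpen_interior.mem_nhds hx)

theorem word_ext_succ {n : ℕ} {w w' : Φ.Word (n + 1)} (h : w.init = w'.init)
    (h' : w (Fin.last n) = w' (Fin.last n)) : w = w' := by
  funext i
  exact Fin.lastCases h' (fun j => congrFun h j) i

/-- If the words differ before the last symbol, use induction and nestedness. Otherwise the open set
condition at the last level is carried forward by a common injective map. -/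
theorem word_disjoint (n : ℕ) {w w' : Φ.Word n} (h : w ≠ w') :
    Disjoint (Φ.word n w '' interior X) (Φ.word n w' '' interior X) := by
  induction n with
  | zero => exact absurd (Subsingleton.elim w w') h
  | succ n ih =>
    rw [word_succ, word_succ, image_comp, image_comp]
    by_cases hi : w.init = w'.init
    · have hl : w (Fin.last n) ≠ w' (Fin.last n) := fun hl => h (word_ext_succ hi hl)
      rw [hi]
      have hsub : ∀ i, Φ.map (0 + n) i '' interior X ⊆ Φ.V := fun i =>
        (map_image_interior_subset _ _).trans (interior_subset.trans Φ.subset_V)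
      exact (Φ.openSet _ _ _ hl).image (word_injOn n _) (hsub _) (hsub _)
    · exact (ih hi).mono (image_mono (map_image_interior_subset _ _))
        (image_mono (map_image_interior_subset _ _))

end NCIFS
end

/-! ### Weights, distortion and volume packing -/

noncomputable section

open MeasureTheory

namespace NCIFS

variable {d : ℕ} {X : Set (EuclideanSpace ℝ (Fin d))} (Φ : NCIFS X)

/-- The scaling factor of the composition along an initial word at a point. -/
def wt (x : EuclideanSpace ℝ (Fin d)) (n : ℕ) (w : Φ.Word n) : ℝ := ‖fderiv ℝ (Φ.word n w) x‖

/-- The initial compositions have distortion at most `K`. -/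
def HasDistortion (K : ℝ) : Prop :=
  1 ≤ K ∧ ∀ (n : ℕ) (w : Φ.Word n), ∀ x ∈ Φ.V, ∀ y ∈ Φ.V, Φ.wt x n w ≤ K * Φ.wt y n w

theorem exists_hasDistortion : ∃ K, Φ.HasDistortion K := by
  obtain ⟨K, hK, h⟩ := Φ.distortion
  exact ⟨K, hK, fun n w => h 0 n w⟩

variable {Φ}

theorem wt_pos [NeZero d] {x : EuclideanSpace ℝ (Fin d)} (hx : x ∈ Φ.V) (n : ℕ) (w : Φ.Word n) :
    0 < Φ.wt x n w := norm_fderiv_word_pos n w hx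

theorem wt_nonneg (x : EuclideanSpace ℝ (Fin d)) (n : ℕ) (w : Φ.Word n) : 0 ≤ Φ.wt x n w :=
  norm_nonneg _

theorem wt_zero [NeZero d] (x : EuclideanSpace ℝ (Fin d)) (w : Φ.Word 0) : Φ.wt x 0 w = 1 := by
  change ‖fderiv ℝ id x‖ = 1
  rw [fderiv_id, ContinuousLinearMap.norm_id]

theorem wt_succ [NeZero d] {x : EuclideanSpace ℝ (Fin d)} (hx : x ∈ Φ.V) (n : ℕ)
    (w : Φ.Word (n + 1)) :
    Φ.wt x (n + 1) w = Φ.wt (Φ.map (0 + n) (w (Fin.last n)) x) n w.init *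
      ‖fderiv ℝ (Φ.map (0 + n) (w (Fin.last n))) x‖ :=
  norm_fderiv_word_succ n w hx

/-- `X` need not be convex, or even connected, so the mean value inequality is replaced by chaining
inside `V`. -/
theorem exists_dist_word_le (hX : IsCompact X) {K : ℝ} (hK : Φ.HasDistortion K) :
    ∃ C : ℝ, 0 < C ∧ ∀ x₀ ∈ X, ∀ (n : ℕ) (w : Φ.Word n), ∀ x ∈ X, ∀ y ∈ X,
      dist (Φ.word n w x) (Φ.word n w y) ≤ C * Φ.wt x₀ n w := by
  obtain ⟨C, hC, h⟩ := hX.exists_dist_image_le Φ.isOpen_V Φ.isConnected_V Φ.subset_V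
  have hK0 : 0 < K := one_pos.trans_le hK.1
  refine ⟨C * K, by positivity, fun x₀ hx₀ n w x hx y hy => ?_⟩
  rw [mul_assoc]
  exact h _ _ (fun z hz => (word_conformalAt n w hz).differentiableAt)
    (fun z hz => hK.2 n w z hz x₀ (Φ.subset_V hx₀)) x hx y hy

theorem measurableSet_word_image (n : ℕ) (w : Φ.Word n) {A : Set (EuclideanSpace ℝ (Fin d))}
    (hA : MeasurableSet A) (hAV : A ⊆ Φ.V) : MeasurableSet (Φ.word n w '' A) :=
  measurable_image_of_fderivWithin hA
    (fun _ hx => (word_conformalAt n w (hAV hx)).differentiableAt.hasFDerivAt.hasFDerivWithinAt)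
    ((word_injOn n w).mono hAV)

theorem le_volume_word_image [NeZero d] {K : ℝ} (hK : Φ.HasDistortion K)
    {x₀ : EuclideanSpace ℝ (Fin d)} (hx₀ : x₀ ∈ X) (n : ℕ) (w : Φ.Word n)
    {A : Set (EuclideanSpace ℝ (Fin d))} (hA : MeasurableSet A) (hAV : A ⊆ Φ.V) :
    ENNReal.ofReal ((Φ.wt x₀ n w / K) ^ d) * volume A ≤ volume (Φ.word n w '' A) := by
  have hK0 : 0 < K := one_pos.trans_le hK.1
  rw [← lintegral_abs_det_fderiv_eq_addHaar_image volume hA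
    (fun x hx => (word_conformalAt n w (hAV hx)).differentiableAt.hasFDerivAt.hasFDerivWithinAt)
    ((word_injOn n w).mono hAV), ← setLIntegral_const]
  refine setLIntegral_mono' hA fun x hx => ENNReal.ofReal_le_ofReal ?_
  rw [(word_isConformalMap n w (hAV hx)).abs_det_eq]
  have h := hK.2 n w x₀ (Φ.subset_V hx₀) x (hAV hx)
  have h0 : 0 ≤ Φ.wt x₀ n w := norm_nonneg _
  gcongr
  rw [div_le_iff₀ hK0, mul_comm]
  exact h

/-- The packing estimate behind both counting results: disjoint images inside `B` cannot have more
volume than `B`, and distortion bounds each volume from below. -/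
theorem sum_volume_le [NeZero d] {K : ℝ} (hK : Φ.HasDistortion K)
    {x₀ : EuclideanSpace ℝ (Fin d)} (hx₀ : x₀ ∈ X) {n : ℕ} (Q : Finset (Φ.Word n))
    (A : Φ.Word n → Set (EuclideanSpace ℝ (Fin d))) (v : Φ.Word n → ℝ)
    {B : Set (EuclideanSpace ℝ (Fin d))} {b : ℝ} (hb : 0 ≤ b)
    (hA : ∀ w ∈ Q, MeasurableSet (A w)) (hAX : ∀ w ∈ Q, A w ⊆ interior X)
    (hv : ∀ w ∈ Q, 0 ≤ v w ∧ ENNReal.ofReal (v w) ≤ volume (A w))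
    (hAB : ∀ w ∈ Q, Φ.word n w '' A w ⊆ B) (hB : volume B ≤ ENNReal.ofReal b) :
    ∑ w ∈ Q, (Φ.wt x₀ n w / K) ^ d * v w ≤ b := by
  have hK0 : 0 < K := one_pos.trans_le hK.1
  have hpos : ∀ w : Φ.Word n, 0 ≤ (Φ.wt x₀ n w / K) ^ d := fun w =>
    pow_nonneg (div_nonneg (norm_nonneg _) hK0.le) _
  have hAV : ∀ w ∈ Q, A w ⊆ Φ.V := fun w hw =>
    (hAX w hw).trans (interior_subset.trans Φ.subset_V)
  rw [← ENNReal.ofReal_le_ofReal_iff hb,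
    ENNReal.ofReal_sum_of_nonneg fun w hw => mul_nonneg (hpos w) (hv w hw).1]
  calc ∑ w ∈ Q, ENNReal.ofReal ((Φ.wt x₀ n w / K) ^ d * v w)
      ≤ ∑ w ∈ Q, volume (Φ.word n w '' A w) := by
        refine Finset.sum_le_sum fun w hw => ?_
        rw [ENNReal.ofReal_mul (hpos w)]
        exact (mul_le_mul_right (hv w hw).2 _).trans
          (le_volume_word_image hK hx₀ n w (hA w hw) (hAV w hw))
    _ = volume (⋃ w ∈ Q, Φ.word n w '' A w) := by
        refine (measure_biUnion_finset (fun w hw w' hw' h => ?_) fun w hw =>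
          measurableSet_word_image n w (hA w hw) (hAV w hw)).symm
        exact (word_disjoint n h).mono (image_mono (hAX w hw)) (image_mono (hAX w' hw'))
    _ ≤ volume B := measure_mono (iUnion₂_subset hAB)
    _ ≤ ENNReal.ofReal b := hB

theorem volume_ball_eq_ofReal [NeZero d] (x : EuclideanSpace ℝ (Fin d)) {r : ℝ} (hr : 0 ≤ r) :
    volume (Metric.ball x r) =
      ENNReal.ofReal (r ^ d * volume.real (Metric.ball (0 : EuclideanSpace ℝ (Fin d)) 1)) := by
  rw [Measure.addHaar_ball _ _ hr, finrank_euclideanSpace_fin, ENNReal.ofReal_mul (by positivity),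
    ofReal_measureReal measure_ball_lt_top.ne]

theorem unitBall_volume_pos :
    0 < volume.real (Metric.ball (0 : EuclideanSpace ℝ (Fin d)) 1) :=
  ENNReal.toReal_pos (Metric.measure_ball_pos volume _ one_pos).ne' measure_ball_lt_top.ne

/-- Images of weight at most r that meet a ball of radius r lie in a ball of comparable radius, and
the volume of each is at least a multiple of the d-th power of its weight. -/
theorem exists_sum_wt_pow_le [NeZero d] (hX : IsCompact X) (hne : (interior X).Nonempty)
    {x₀ : EuclideanSpace ℝ (Fin d)} (hx₀ : x₀ ∈ X) :
    ∃ C : ℝ, 0 < C ∧ ∀ (n : ℕ) (Q : Finset (Φ.Word n)) (x : EuclideanSpace ℝ (Fin d)) (r : ℝ),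
      0 < r → (∀ w ∈ Q, (Φ.word n w '' X ∩ Metric.ball x r).Nonempty ∧ Φ.wt x₀ n w ≤ r) →
        ∑ w ∈ Q, Φ.wt x₀ n w ^ d ≤ C * r ^ d := by
  obtain ⟨K, hK⟩ := Φ.exists_hasDistortion
  have hK0 : 0 < K := one_pos.trans_le hK.1
  obtain ⟨C, hC, hdist⟩ := exists_dist_word_le hX hK
  set υ := volume.real (Metric.ball (0 : EuclideanSpace ℝ (Fin d)) 1)
  have hυ : 0 < υ := unitBall_volume_pos
  have hfin : volume (interior X) ≠ ⊤ := (hX.isBounded.subset interior_subset).measure_lt_top.ne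
  set v := volume.real (interior X)
  have hv : 0 < v :=
    ENNReal.toReal_pos (isOpen_interior.measure_pos volume hne).ne' hfin
  refine ⟨K ^ d * (1 + C) ^ d * υ / v, by positivity, fun n Q x r hr hQ => ?_⟩
  have h := sum_volume_le hK hx₀ Q (fun _ => interior X) (fun _ => v)
    (B := Metric.ball x ((1 + C) * r)) (b := ((1 + C) * r) ^ d * υ) (by positivity)
    (fun _ _ => isOpen_interior.measurableSet) (fun _ _ => Subset.rfl)
    (fun _ _ => ⟨hv.le, (ofReal_measureReal hfin).le⟩) ?_
    (volume_ball_eq_ofReal x (by positivity)).le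
  · rw [← Finset.sum_mul] at h
    have h2 : ∑ w ∈ Q, (Φ.wt x₀ n w / K) ^ d = (∑ w ∈ Q, Φ.wt x₀ n w ^ d) / K ^ d := by
      rw [Finset.sum_div]
      exact Finset.sum_congr rfl fun w _ => div_pow _ _ _
    rw [h2, ← le_div_iff₀ hv, div_le_iff₀ (by positivity)] at h
    refine h.trans_eq ?_
    rw [mul_pow]; ring
  · rintro w hw _ ⟨y, hy, rfl⟩
    obtain ⟨⟨_, ⟨z, hz, rfl⟩, hzx⟩, hle⟩ := hQ w hw
    rw [Metric.mem_ball] at *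
    have h1 := hdist x₀ hx₀ n w y (interior_subset hy) z hz
    have h2 : C * Φ.wt x₀ n w ≤ C * r := by gcongr
    linarith [dist_triangle (Φ.word n w y) (Φ.word n w z) x]

/-- Here the images may be much larger than the ball, so packing uses only a part of each: a ball in
the interior of `X`, near a preimage z of a point of the ball and of size r / weight, whose image
has volume comparable to r^d. Fatness of the interior provides it. -/
theorem exists_card_le [NeZero d] (hX : IsPhaseSpace X)
    {x₀ : EuclideanSpace ℝ (Fin d)} (hx₀ : x₀ ∈ X) :
    ∃ C : ℝ, 0 < C ∧ ∀ (n : ℕ) (Q : Finset (Φ.Word n)) (x : EuclideanSpace ℝ (Fin d)) (r : ℝ),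
      0 < r → (∀ w ∈ Q, (Φ.word n w '' X ∩ Metric.ball x r).Nonempty ∧ r ≤ Φ.wt x₀ n w) →
        (Q.card : ℝ) ≤ C := by
  obtain ⟨K, hK⟩ := Φ.exists_hasDistortion
  have hK0 : 0 < K := one_pos.trans_le hK.1
  obtain ⟨c, s₀, hc, hs₀, hfat⟩ := hX.fatInteriorOn
  obtain ⟨δ, hδ, hδV⟩ := hX.isCompact.exists_thickening_subset_open Φ.isOpen_V Φ.subset_V
  -- Balls of radius s₁ around points of `X` lie in `V`, where distortion yields a Lipschitz bound.
  set s₁ := min s₀ δ with hs₁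
  have hs₁0 : 0 < s₁ := lt_min hs₀ hδ
  set υ := volume.real (Metric.ball (0 : EuclideanSpace ℝ (Fin d)) 1) with hυ'
  have hυ : 0 < υ := unitBall_volume_pos
  refine ⟨((1 + K * s₁) * K / (c * s₁)) ^ d, by positivity, fun n Q x r hr hQ => ?_⟩
  have hwt : ∀ w : Φ.Word n, 0 < Φ.wt x₀ n w := fun w => wt_pos (Φ.subset_V hx₀) n w
  have hex : ∀ w : Φ.Word n, ∃ p, w ∈ Q →
      Metric.ball p (c * (s₁ * (r / Φ.wt x₀ n w))) ⊆ interior X ∧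
      Φ.word n w '' Metric.ball p (c * (s₁ * (r / Φ.wt x₀ n w))) ⊆
        Metric.ball x ((1 + K * s₁) * r) := by
    intro w
    by_cases hw : w ∈ Q
    swap
    · exact ⟨0, fun h => absurd h hw⟩
    obtain ⟨⟨_, ⟨z, hz, rfl⟩, hzx⟩, hle⟩ := hQ w hw
    have h0 := hwt w
    -- The lower bound r on the weight is used here: it keeps the scale in the range where fatness
    -- holds.
    have hs : s₁ * (r / Φ.wt x₀ n w) ≤ s₁ :=
      mul_le_of_le_one_right hs₁0.le ((div_le_one h0).2 hle)
    obtain ⟨p, hp⟩ := hfat z ⟨hz, hz⟩ (s₁ * (r / Φ.wt x₀ n w)) (by positivity)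
      (hs.trans (min_le_left _ _))
    refine ⟨p, fun _ => ⟨fun y hy => (hp hy).1, ?_⟩⟩
    rintro _ ⟨y, hy, rfl⟩
    have hyz := (hp hy).2
    have hbV : Metric.ball z s₁ ⊆ Φ.V :=
      (Metric.ball_subset_ball (min_le_right _ _)).trans
        ((Metric.ball_subset_thickening hz δ).trans hδV)
    have hlip := (convex_ball z s₁).norm_image_sub_le_of_norm_fderiv_le
      (fun u hu => (word_conformalAt n w (hbV hu)).differentiableAt)
      (fun u hu => hK.2 n w u (hbV hu) x₀ (Φ.subset_V hx₀))
      (Metric.mem_ball_self hs₁0) (Metric.ball_subset_ball hs hyz)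
    rw [← dist_eq_norm, ← dist_eq_norm] at hlip
    rw [Metric.mem_ball] at *
    have h1 : K * Φ.wt x₀ n w * dist y z ≤ K * Φ.wt x₀ n w * (s₁ * (r / Φ.wt x₀ n w)) := by
      gcongr
    have h2 : K * Φ.wt x₀ n w * (s₁ * (r / Φ.wt x₀ n w)) = K * s₁ * r := by
      field_simp
    linarith [dist_triangle (Φ.word n w y) (Φ.word n w z) x]
  choose p hp using hex
  have h := sum_volume_le hK hx₀ Q
    (fun w => Metric.ball (p w) (c * (s₁ * (r / Φ.wt x₀ n w))))
    (fun w => (c * (s₁ * (r / Φ.wt x₀ n w))) ^ d * υ)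
    (B := Metric.ball x ((1 + K * s₁) * r)) (b := ((1 + K * s₁) * r) ^ d * υ) (by positivity)
    (fun _ _ => Metric.isOpen_ball.measurableSet) (fun w hw => (hp w hw).1)
    (fun w _ => ⟨by have := hwt w; positivity,
      (volume_ball_eq_ofReal _ (by have := hwt w; positivity)).ge⟩)
    (fun w hw => (hp w hw).2) (volume_ball_eq_ofReal x (by positivity)).le
  have hterm : ∀ w : Φ.Word n, (Φ.wt x₀ n w / K) ^ d *
      ((c * (s₁ * (r / Φ.wt x₀ n w))) ^ d * υ) = (c * s₁ * r / K) ^ d * υ := by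
    intro w
    rw [← mul_assoc, ← mul_pow]
    congr 2
    have := (hwt w).ne'
    field_simp
  rw [Finset.sum_congr rfl fun w _ => hterm w, Finset.sum_const, nsmul_eq_mul, ← mul_assoc] at h
  have h3 := le_of_mul_le_mul_right h hυ
  rw [← le_div_iff₀ (by positivity), ← div_pow] at h3
  refine h3.trans_eq ?_
  congr 1
  field_simp

end NCIFS
end

/-! ### A mass distribution principle without a limit measure -/

noncomputable section

open MeasureTheory

theorem Finset.sum_biUnion_le_of_nonneg {ι κ M : Type*} [DecidableEq κ] [AddCommMonoid M]
    [PartialOrder M] [IsOrderedAddMonoid M] (F : Finset ι) (Q : ι → Finset κ) (f : κ → M)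
    (hf : ∀ w, 0 ≤ f w) : ∑ w ∈ F.biUnion Q, f w ≤ ∑ i ∈ F, ∑ w ∈ Q i, f w := by
  classical
  induction F using Finset.induction_on with
  | empty => simp
  | insert i F hi ih =>
    rw [Finset.biUnion_insert, Finset.sum_insert hi]
    refine le_trans ?_ (add_le_add le_rfl ih)
    rw [← Finset.sum_union_inter]
    exact le_add_of_nonneg_right (Finset.sum_nonneg fun w _ => hf w)

/-- The mass distribution principle for nested finite unions of compact sets. -/
theorem le_dimH_of_mass_ball_le {E : Type*} [MetricSpace E] {W : ℕ → Type*} [∀ n, Fintype (W n)]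
    (T : ∀ n, W n → Set E) (μ : ∀ n, W n → ℝ≥0∞) (hμ : ∀ n, ∑ w, μ n w = 1)
    (hne : ∀ n w, (T n w).Nonempty) (hc : ∀ n, IsCompact (⋃ w, T n w))
    (hanti : Antitone fun n => ⋃ w, T n w) {s : ℝ≥0} {C : ℝ≥0∞} (hC : C ≠ ⊤)
    (h : ∀ x : E, ∀ r : ℝ, 0 < r → r ≤ 1 → ∀ᶠ n in atTop, ∀ Q : Finset (W n),
      (∀ w ∈ Q, (T n w ∩ Metric.ball x r).Nonempty) →
        ∑ w ∈ Q, μ n w ≤ C * ENNReal.ofReal r ^ (s : ℝ)) :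
    (s : ℝ≥0∞) ≤ dimH (⋂ n, ⋃ w, T n w) := by
  classical
  borelize E
  by_contra! hlt
  have hs : 0 < (s : ℝ) := by
    rcases eq_or_ne s 0 with rfl | h0
    · simp at hlt
    · exact_mod_cast pos_iff_ne_zero.2 h0
  have hH := hausdorffMeasure_of_dimH_lt hlt
  -- The factor 2^s pays for splitting (diam + δ)^s into two separate powers.
  set D : ℝ≥0∞ := C * 2 ^ (s : ℝ) with hD
  have hDtop : D ≠ ⊤ := ENNReal.mul_ne_top hC (ENNReal.rpow_ne_top_of_nonneg hs.le (by simp))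
  obtain ⟨η, hη, hηD⟩ : ∃ η : ℝ≥0∞, 0 < η ∧ D * (η + η) < 1 := by
    refine ⟨(4 * (D + 1))⁻¹, ENNReal.inv_pos.2 (ENNReal.mul_ne_top (by simp) (by simp [hDtop])), ?_⟩
    have h1 : (4 * (D + 1))⁻¹ + (4 * (D + 1))⁻¹ = (2 * (D + 1))⁻¹ := by
      rw [ENNReal.mul_inv (by simp) (by simp), ENNReal.mul_inv (by simp) (by simp), ← add_mul]
      congr 1
      rw [show (4 : ℝ≥0∞) = 2 * 2 by norm_num, ENNReal.mul_inv (by simp) (by simp), ← mul_add,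
        ENNReal.inv_two_add_inv_two, mul_one]
    rw [h1, ← div_eq_mul_inv, ENNReal.div_lt_iff (by simp) (by simp [hDtop]), one_mul]
    calc D < D + 1 := ENNReal.lt_add_right hDtop one_ne_zero
      _ ≤ 2 * (D + 1) := le_mul_of_one_le_left zero_le one_le_two
  rw [Measure.hausdorffMeasure_apply] at hH
  have hH2 := (iSup₂_le_iff.1 hH.le 2⁻¹ (by simp)).trans_lt hη
  simp only [iInf_lt_iff] at hH2
  obtain ⟨t, hcov, hdiam, hsum⟩ := hH2
  let ι := {i : ℕ // (t i).Nonempty}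
  obtain ⟨e, he, hesum⟩ := ENNReal.exists_pos_sum_of_countable hη.ne' ι
  choose p hp using fun i : ι => i.2
  -- Covering sets are enlarged to open balls; the excess is summable in s-th power, and the cap 1/2
  -- keeps the radii at most 1.
  let δ : ι → ℝ≥0∞ := fun i => min 2⁻¹ ((e i : ℝ≥0∞) ^ (s : ℝ)⁻¹)
  have hδ0 : ∀ i, 0 < δ i := fun i => lt_min (by simp)
    (ENNReal.rpow_pos (by exact_mod_cast he i) (by simp))
  have hδs : ∀ i, δ i ^ (s : ℝ) ≤ e i := fun i => by
    calc δ i ^ (s : ℝ) ≤ ((e i : ℝ≥0∞) ^ (s : ℝ)⁻¹) ^ (s : ℝ) := by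
          gcongr; exact min_le_right _ _
      _ = e i := ENNReal.rpow_inv_rpow hs.ne' _
  let ρ : ι → ℝ≥0∞ := fun i => Metric.ediam (t i) + δ i
  have hρ1 : ∀ i, ρ i ≤ 1 := fun i => by
    calc ρ i ≤ 2⁻¹ + 2⁻¹ := add_le_add (hdiam i) (min_le_left _ _)
      _ = 1 := ENNReal.inv_two_add_inv_two
  have hρtop : ∀ i, ρ i ≠ ⊤ := fun i => ((hρ1 i).trans_lt ENNReal.one_lt_top).ne
  have hρ0 : ∀ i, 0 < ρ i := fun i => (hδ0 i).trans_le le_add_self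
  have hρs : ∀ i, ρ i ^ (s : ℝ) ≤ 2 ^ (s : ℝ) * (Metric.ediam (t i) ^ (s : ℝ) + e i) := by
    intro i
    have haux : ∀ a b : ℝ≥0∞, (a + b) ^ (s : ℝ) ≤ 2 ^ (s : ℝ) * (a ^ (s : ℝ) + b ^ (s : ℝ)) := by
      intro a b
      rcases le_total a b with hab | hab
      · calc (a + b) ^ (s : ℝ) ≤ (2 * b) ^ (s : ℝ) := by
              gcongr; rw [two_mul]; gcongr
          _ = 2 ^ (s : ℝ) * b ^ (s : ℝ) := ENNReal.mul_rpow_of_nonneg _ _ hs.le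
          _ ≤ _ := by gcongr; exact le_add_self
      · calc (a + b) ^ (s : ℝ) ≤ (2 * a) ^ (s : ℝ) := by
              gcongr; rw [two_mul]; gcongr
          _ = 2 ^ (s : ℝ) * a ^ (s : ℝ) := ENNReal.mul_rpow_of_nonneg _ _ hs.le
          _ ≤ _ := by gcongr; exact le_self_add
    exact (haux _ _).trans (by gcongr; exact hδs i)
  have hsub : ∀ i : ι, t i ⊆ Metric.ball (p i) (ρ i).toReal := by
    intro i y hy
    rw [Metric.mem_ball, ← ENNReal.ofReal_lt_ofReal_iff (ENNReal.toReal_pos (hρ0 i).ne' (hρtop i)),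
      ← edist_dist, ENNReal.ofReal_toReal (hρtop i)]
    refine (Metric.edist_le_ediam_of_mem hy (hp i)).trans_lt (ENNReal.lt_add_right ?_ (hδ0 i).ne')
    exact ((hdiam i).trans_lt (by simp)).ne
  -- A decreasing sequence of compact sets enters every open neighbourhood of its intersection, so
  -- the cover of the limit set already covers a finite level.
  obtain ⟨n₀, hn₀⟩ : ∃ n, (⋃ w, T n w) ⊆ ⋃ i : ι, Metric.ball (p i) (ρ i).toReal := by
    refine exists_subset_nhds_of_isCompact (directed_of_isDirected_le
      (fun m n hmn => hanti hmn)) hc fun x hx => ?_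
    refine (isOpen_iUnion fun i => Metric.isOpen_ball).mem_nhds ?_
    obtain ⟨i, hi⟩ := mem_iUnion.1 (hcov hx)
    exact mem_iUnion.2 ⟨⟨i, x, hi⟩, hsub _ hi⟩
  -- With finitely many balls, the eventual mass bounds hold at one common level n.
  obtain ⟨F, hF⟩ := (hc n₀).elim_finite_subcover _ (fun i => Metric.isOpen_ball) hn₀
  have hev := (Filter.eventually_all_finset F).2 fun i _ =>
    h (p i) (ρ i).toReal (ENNReal.toReal_pos (hρ0 i).ne' (hρtop i))
      (ENNReal.toReal_le_of_le_ofReal zero_le_one (by simpa using hρ1 i))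
  obtain ⟨n, hn, hnn₀⟩ := (hev.and (eventually_ge_atTop n₀)).exists
  let Q : ι → Finset (W n) := fun i =>
    {w | (T n w ∩ Metric.ball (p i) (ρ i).toReal).Nonempty}
  have hall : (Finset.univ : Finset (W n)) ⊆ F.biUnion Q := by
    intro w _
    obtain ⟨y, hy⟩ := hne n w
    have hy' := hF (hanti hnn₀ (mem_iUnion.2 ⟨w, hy⟩))
    simp only [mem_iUnion] at hy'
    obtain ⟨i, hi, hyi⟩ := hy'
    exact Finset.mem_biUnion.2 ⟨i, hi, Finset.mem_filter.2 ⟨Finset.mem_univ _, y, hy, hyi⟩⟩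
  have hlast : (1 : ℝ≥0∞) ≤ D * (η + η) := by
    calc (1 : ℝ≥0∞) = ∑ w, μ n w := (hμ n).symm
      _ ≤ ∑ w ∈ F.biUnion Q, μ n w := Finset.sum_le_sum_of_subset hall
      _ ≤ ∑ i ∈ F, ∑ w ∈ Q i, μ n w := Finset.sum_biUnion_le_of_nonneg _ _ _ fun _ => zero_le
      _ ≤ ∑ i ∈ F, D * (Metric.ediam (t i) ^ (s : ℝ) + e i) := by
          refine Finset.sum_le_sum fun i hi => ?_
          refine (hn i hi (Q i) fun w hw => (Finset.mem_filter.1 hw).2).trans ?_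
          rw [ENNReal.ofReal_toReal (hρtop i), hD, mul_assoc]
          gcongr
          exact hρs i
      _ = D * (∑ i ∈ F, Metric.ediam (t i) ^ (s : ℝ) + ∑ i ∈ F, (e i : ℝ≥0∞)) := by
          rw [← Finset.mul_sum, Finset.sum_add_distrib]
      _ ≤ D * (η + η) := by
          gcongr
          · refine le_trans ?_ hsum.le
            refine (ENNReal.sum_le_tsum F).trans ?_
            refine le_trans (ENNReal.tsum_le_tsum fun i => ?_)
              (ENNReal.tsum_comp_le_tsum_of_injective (f := fun i : ι => (i : ℕ))
                Subtype.val_injective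
                (fun n => ⨆ (_ : (t n).Nonempty), Metric.ediam (t n) ^ (s : ℝ)))
            exact le_iSup (fun _ : (t i).Nonempty => Metric.ediam (t i) ^ (s : ℝ)) i.2
          · exact (ENNReal.sum_le_tsum F).trans hesum.le
  exact absurd hηD (not_lt.2 hlast)

end

/-! ### Stopping words and the mass of a ball -/

noncomputable section

open MeasureTheory

theorem Real.rpow_le_add_rpow_mul {a β t D : ℝ} (ha : 0 < a) (hβ : 0 < β) (ht : 0 ≤ t)
    (htD : t ≤ D) : a ^ t ≤ β ^ t + β ^ (t - D) * a ^ D := by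
  rcases le_total a β with h | h
  · have h1 := Real.rpow_le_rpow ha.le h ht
    have h2 : 0 ≤ β ^ (t - D) * a ^ D := by positivity
    linarith
  · have h1 : a ^ t = a ^ (t - D) * a ^ D := by rw [← Real.rpow_add ha]; congr 1; ring
    have h2 : a ^ (t - D) ≤ β ^ (t - D) :=
      Real.rpow_le_rpow_of_nonpos hβ h (by linarith)
    have h3 : a ^ (t - D) * a ^ D ≤ β ^ (t - D) * a ^ D := by gcongr
    have h4 : 0 ≤ β ^ t := by positivity
    linarith

namespace NCIFS

variable {d : ℕ} {X : Set (EuclideanSpace ℝ (Fin d))} {Φ : NCIFS X}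

/-- The prefix of length `k` of a word. -/
def Word.take {k n : ℕ} (h : k ≤ n) (w : Φ.Word n) : Φ.Word k := fun i => w (Fin.castLE h i)

/-- The word with one more symbol at its end. -/
def Word.snoc {n : ℕ} (u : Φ.Word n) (i : Φ.I (0 + n)) : Φ.Word (n + 1) :=
  Fin.snoc (α := fun j : Fin (n + 1) => Φ.I (0 + j)) u i

theorem Word.init_snoc {n : ℕ} (u : Φ.Word n) (i : Φ.I (0 + n)) : (u.snoc i).init = u := by
  funext j
  exact Fin.snoc_castSucc (α := fun j : Fin (n + 1) => Φ.I (0 + j)) i u j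

theorem Word.snoc_last {n : ℕ} (u : Φ.Word n) (i : Φ.I (0 + n)) :
    u.snoc i (Fin.last n) = i :=
  Fin.snoc_last (α := fun j : Fin (n + 1) => Φ.I (0 + j)) i u

theorem Word.take_snoc {k n : ℕ} (h : k ≤ n) (u : Φ.Word n) (i : Φ.I (0 + n)) :
    (u.snoc i).take (h.trans n.le_succ) = u.take h := by
  conv_rhs => rw [← Word.init_snoc u i]
  rfl

theorem word_image_subset_take {k n : ℕ} (h : k ≤ n) (w : Φ.Word n) :
    Φ.word n w '' X ⊆ Φ.word k (w.take h) '' X := by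
  induction n, h using Nat.le_induction with
  | base => exact Subset.rfl
  | succ n hn ih =>
    rw [word_succ, image_comp]
    exact (image_mono (Φ.mapsTo _ _).image_subset).trans (ih w.init)

theorem continuousOn_word (n : ℕ) (w : Φ.Word n) : ContinuousOn (Φ.word n w) X := fun _ hx =>
  (word_conformalAt n w (Φ.subset_V hx)).differentiableAt.continuousAt.continuousWithinAt

/-- The words `ρ` of length `k + 1` whose images of `X` meet a set and whose scaling factors are
below `r`, while those of the words without the last symbol are not. -/
def Stops (Φ : NCIFS X) (x₀ : EuclideanSpace ℝ (Fin d)) (B : Set (EuclideanSpace ℝ (Fin d)))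
    (r : ℝ) (k : ℕ) (ρ : Φ.Word (k + 1)) : Prop :=
  (Φ.word (k + 1) ρ '' X ∩ B).Nonempty ∧ Φ.wt x₀ (k + 1) ρ < r ∧ r ≤ Φ.wt x₀ k ρ.init

theorem exists_stops_take [NeZero d] {x₀ : EuclideanSpace ℝ (Fin d)}
    {B : Set (EuclideanSpace ℝ (Fin d))} {r : ℝ} (hr : r ≤ 1) {n : ℕ} (w : Φ.Word n)
    (hw : Φ.wt x₀ n w < r) (hB : (Φ.word n w '' X ∩ B).Nonempty) :
    ∃ k, ∃ h : k + 1 ≤ n, Φ.Stops x₀ B r k (w.take h) := by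
  classical
  have hex : ∃ j, ∃ h : j ≤ n, Φ.wt x₀ j (w.take h) < r := ⟨n, le_rfl, hw⟩
  obtain ⟨hj, hlt⟩ := Nat.find_spec hex
  have hmin := fun m => Nat.find_min (m := m) hex
  generalize Nat.find hex = j at hj hlt hmin
  -- The shortest prefix of weight below r is not empty, because the empty word has weight 1 ≥ r.
  rcases j with _ | k
  · rw [wt_zero] at hlt
    exact absurd hlt (not_lt.2 hr)
  · refine ⟨k, hj, hB.mono (inter_subset_inter_left _ (word_image_subset_take hj w)), hlt, ?_⟩
    by_contra! hc
    exact hmin k k.lt_succ_self ⟨k.le_succ.trans hj, hc⟩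

theorem limitSet_eq_iInter (Φ : NCIFS X) :
    Φ.limitSet = ⋂ n : ℕ, ⋃ w : Φ.Word n, Φ.word n w '' X := by
  refine Subset.antisymm (fun y hy => mem_iInter.2 fun n => ?_)
    (fun y hy => mem_iInter₂.2 fun n _ => mem_iInter.1 hy n)
  rcases Nat.eq_zero_or_pos n with rfl | hn
  · obtain ⟨w, hw⟩ := mem_iUnion.1 (mem_iInter₂.1 hy 1 le_rfl)
    exact mem_iUnion.2 ⟨Word.take zero_le_one w,
      word_image_subset_take zero_le_one w hw⟩
  · exact mem_iInter₂.1 hy n hn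

variable [∀ n, Fintype (Φ.I n)]

theorem sum_word_succ {M : Type*} [AddCommMonoid M] {n : ℕ} (F : Φ.Word (n + 1) → M) :
    ∑ w, F w = ∑ i : Φ.I (0 + n), ∑ u : Φ.Word n, F (u.snoc i) := by
  rw [← Fintype.sum_prod_type']
  exact ((Fin.snocEquiv fun j : Fin (n + 1) => Φ.I (0 + j)).sum_comp F).symm

/-- The partition function, with scaling factors taken at a point. -/
def part (Φ : NCIFS X) [∀ n, Fintype (Φ.I n)] (x : EuclideanSpace ℝ (Fin d)) (t : ℝ) (n : ℕ) : ℝ :=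
  ∑ w, Φ.wt x n w ^ t

instance nonempty_word (Φ : NCIFS X) (n : ℕ) : Nonempty (Φ.Word n) :=
  ⟨fun _ => (Φ.nonempty_I _).some⟩

theorem part_pos [NeZero d] {x : EuclideanSpace ℝ (Fin d)} (hx : x ∈ Φ.V) (t : ℝ) (n : ℕ) :
    0 < Φ.part x t n :=
  Finset.sum_pos (fun w _ => Real.rpow_pos_of_pos (wt_pos hx n w) _) Finset.univ_nonempty

/-- Removing the last symbol replaces the base point y by its image in `V` and takes out a
nonnegative factor. An inequality valid at all points of `V` therefore passes to longer words
without loss. -/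
theorem sum_take_nonneg [NeZero d] {k : ℕ} (t : ℝ) (f : Φ.Word k → ℝ)
    (hf : ∀ y ∈ Φ.V, 0 ≤ ∑ u, f u * Φ.wt y k u ^ t) {n : ℕ} (h : k ≤ n) :
    ∀ y ∈ Φ.V, 0 ≤ ∑ w : Φ.Word n, f (w.take h) * Φ.wt y n w ^ t := by
  induction n, h using Nat.le_induction with
  | base => exact hf
  | succ n hn ih =>
    intro y hy
    rw [sum_word_succ]
    refine Finset.sum_nonneg fun i _ => ?_
    have hterm : ∀ u : Φ.Word n, f ((u.snoc i).take (hn.trans n.le_succ)) *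
        Φ.wt y (n + 1) (u.snoc i) ^ t =
        (f (u.take hn) * Φ.wt (Φ.map (0 + n) i y) n u ^ t) *
          ‖fderiv ℝ (Φ.map (0 + n) i) y‖ ^ t := by
      intro u
      rw [Word.take_snoc, wt_succ hy, Word.init_snoc, Word.snoc_last,
        Real.mul_rpow (wt_nonneg _ _ _) (norm_nonneg _), mul_assoc]
    rw [Finset.sum_congr rfl fun u _ => hterm u, ← Finset.sum_mul]
    exact mul_nonneg (ih _ (Φ.mapsTo_V _ _ hy)) (Real.rpow_nonneg (norm_nonneg _) _)

/-- The mass that descends from `P` is comparable to the mass of `P` at level k, with a constant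
independent of n: distortion is paid only at level k, to make the inequality uniform in the base
point, before `sum_take_nonneg` takes it to level n. -/
theorem sum_take_mem_le [NeZero d] {K : ℝ} (hK : Φ.HasDistortion K)
    {x : EuclideanSpace ℝ (Fin d)} (hx : x ∈ Φ.V) {t : ℝ} (ht : 0 ≤ t) {k n : ℕ} (h : k ≤ n)
    (P : Finset (Φ.Word k)) (Q : Finset (Φ.Word n)) (hQ : ∀ w ∈ Q, w.take h ∈ P) :
    ∑ w ∈ Q, Φ.wt x n w ^ t ≤
      K ^ t * K ^ t * (∑ u ∈ P, Φ.wt x k u ^ t) / Φ.part x t k * Φ.part x t n := by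
  classical
  have hK0 : 0 < K := one_pos.trans_le hK.1
  set S := ∑ u ∈ P, Φ.wt x k u ^ t with hS
  have hS0 : 0 ≤ S := Finset.sum_nonneg fun u _ => Real.rpow_nonneg (wt_nonneg _ _ _) _
  have hZ := part_pos hx t k
  have hcomp : ∀ y ∈ Φ.V, ∀ z ∈ Φ.V, ∀ u : Φ.Word k, Φ.wt y k u ^ t ≤ K ^ t * Φ.wt z k u ^ t := by
    intro y hy z hz u
    rw [← Real.mul_rpow hK0.le (wt_nonneg _ _ _)]
    exact Real.rpow_le_rpow (wt_nonneg _ _ _) (hK.2 k u y hy z hz) ht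
  set c := K ^ t * K ^ t * S / Φ.part x t k with hc
  have key := sum_take_nonneg (Φ := Φ) t (fun u => c - if u ∈ P then 1 else 0) (by
    intro y hy
    simp only [sub_mul, Finset.sum_sub_distrib, ite_mul, one_mul, zero_mul, ← Finset.mul_sum]
    rw [Finset.sum_ite_mem, Finset.univ_inter, sub_nonneg]
    have h1 : ∑ u ∈ P, Φ.wt y k u ^ t ≤ K ^ t * S := by
      rw [hS, Finset.mul_sum]
      exact Finset.sum_le_sum fun u _ => hcomp y hy x hx u
    have h2 : Φ.part x t k ≤ K ^ t * ∑ u, Φ.wt y k u ^ t := by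
      rw [part, Finset.mul_sum]
      exact Finset.sum_le_sum fun u _ => hcomp x hx y hy u
    refine h1.trans ?_
    rw [hc, div_mul_eq_mul_div, le_div_iff₀ hZ]
    calc K ^ t * S * Φ.part x t k ≤ K ^ t * S * (K ^ t * ∑ u, Φ.wt y k u ^ t) := by gcongr
      _ = _ := by ring) h x hx
  simp only [sub_mul, Finset.sum_sub_distrib, ite_mul, one_mul, zero_mul, ← Finset.mul_sum,
    sub_nonneg] at key
  refine le_trans ?_ key
  rw [← Finset.sum_filter]
  exact Finset.sum_le_sum_of_subset_of_nonneg
    (fun w hw => Finset.mem_filter.2 ⟨Finset.mem_univ _, hQ w hw⟩)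
    (fun w _ _ => Real.rpow_nonneg (wt_nonneg _ _ _) _)

/-- The first bound groups words by their prefixes of length k, of which boundedly many occur. The
second uses the prefixes of length k + 1, whose cardinality and d-th power sum are both controlled,
and interpolates between the exponents 0 and d. -/
theorem exists_sum_stops_le [NeZero d] (hX : IsPhaseSpace X)
    {x₀ : EuclideanSpace ℝ (Fin d)} (hx₀ : x₀ ∈ X) {W : ℝ} (hW : ∀ n w, Φ.wt x₀ n w ≤ W)
    {t : ℝ} (ht : 0 ≤ t) (htd : t ≤ d) :
    ∃ C : ℝ, 0 < C ∧ ∀ (x : EuclideanSpace ℝ (Fin d)) (r : ℝ), 0 < r →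
      ∀ (k n : ℕ) (h : k + 1 ≤ n) (Q : Finset (Φ.Word n)),
        (∀ w ∈ Q, Φ.Stops x₀ (Metric.ball x r) r k (w.take h)) →
        ∑ w ∈ Q, Φ.wt x₀ n w ^ t ≤ C * min (1 / Φ.part x₀ t k)
          ((Nat.card (Φ.I k) : ℝ) ^ (1 - t / d) * r ^ t / Φ.part x₀ t (k + 1)) *
            Φ.part x₀ t n := by
  classical
  have hd0 : (0 : ℝ) < d := by exact_mod_cast Nat.pos_of_neZero d
  obtain ⟨K, hK⟩ := Φ.exists_hasDistortion
  have hK0 : 0 < K := one_pos.trans_le hK.1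
  have hxV := Φ.subset_V hx₀
  obtain ⟨C₁, hC₁, hsum⟩ := exists_sum_wt_pow_le (Φ := Φ) hX.isCompact hX.interior_nonempty hx₀
  obtain ⟨C₂, hC₂, hcard⟩ := exists_card_le (Φ := Φ) hX hx₀
  have hWpos : 0 < W := (wt_pos hxV 0 (Classical.arbitrary _)).trans_le (hW 0 _)
  refine ⟨max (K ^ t * K ^ t * (C₂ * W ^ t)) (K ^ t * K ^ t * (C₂ + C₁)), by positivity,
    fun x r hr k n h Q hQ => ?_⟩
  set R : Finset (Φ.Word k) :=
    {u | (Φ.word k u '' X ∩ Metric.ball x r).Nonempty ∧ r ≤ Φ.wt x₀ k u} with hR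
  set S : Finset (Φ.Word (k + 1)) := {ρ | Φ.Stops x₀ (Metric.ball x r) r k ρ} with hS
  have hRcard : (R.card : ℝ) ≤ C₂ := hcard k R x r hr fun u hu => (Finset.mem_filter.1 hu).2
  have hSR : ∀ ρ ∈ S, ρ.init ∈ R := by
    intro ρ hρ
    obtain ⟨h1, -, h3⟩ := (Finset.mem_filter.1 hρ).2
    exact Finset.mem_filter.2 ⟨Finset.mem_univ _,
      h1.mono (inter_subset_inter_left _ (word_image_subset_take k.le_succ ρ)), h3⟩
  have hZ := fun m => part_pos (Φ := Φ) hxV t m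
  rw [mul_min_of_nonneg _ _ (by positivity), min_mul_of_nonneg _ _ (hZ n).le]
  refine le_min ?_ ?_
  · refine (sum_take_mem_le hK hxV ht (k.le_succ.trans h) R Q fun w hw => ?_).trans ?_
    · exact hSR (w.take h) (Finset.mem_filter.2 ⟨Finset.mem_univ _, hQ w hw⟩)
    · have h1 : ∑ u ∈ R, Φ.wt x₀ k u ^ t ≤ C₂ * W ^ t := by
        calc ∑ u ∈ R, Φ.wt x₀ k u ^ t ≤ ∑ u ∈ R, W ^ t := Finset.sum_le_sum fun u _ =>
              Real.rpow_le_rpow (wt_nonneg _ _ _) (hW k u) ht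
          _ = R.card * W ^ t := by rw [Finset.sum_const, nsmul_eq_mul]
          _ ≤ C₂ * W ^ t := by gcongr
      have hZk := hZ k
      have hZn := hZ n
      rw [mul_one_div]
      gcongr
      refine le_trans ?_ (le_max_left _ _)
      gcongr
  · refine (sum_take_mem_le hK hxV ht h S Q fun w hw =>
      Finset.mem_filter.2 ⟨Finset.mem_univ _, hQ w hw⟩).trans ?_
    have hZk := hZ (k + 1)
    have hZn := hZ n
    rw [← mul_div_assoc]
    refine mul_le_mul_of_nonneg_right (div_le_div_of_nonneg_right ?_ hZk.le) hZn.le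
    have := Φ.nonempty_I k
    set N : ℝ := (Nat.card (Φ.I k) : ℝ) with hN
    have hN0 : 0 < N := by
      rw [hN]; exact_mod_cast Nat.card_pos
    have hScard : (S.card : ℝ) ≤ C₂ * N := by
      have h1 : S.card ≤ (R ×ˢ (Finset.univ : Finset (Φ.I (0 + k)))).card := by
        refine Finset.card_le_card_of_injOn (fun ρ => (ρ.init, ρ (Fin.last k))) ?_ ?_
        · intro ρ hρ
          exact Finset.mem_coe.2 (Finset.mem_product.2 ⟨hSR ρ hρ, Finset.mem_univ _⟩)
        · intro ρ _ ρ' _ he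
          exact word_ext_succ (congrArg Prod.fst he) (congrArg Prod.snd he)
      have h2 : (Finset.univ : Finset (Φ.I (0 + k))).card = Nat.card (Φ.I k) := by
        rw [Finset.card_univ, ← Nat.card_eq_fintype_card, zero_add]
      rw [Finset.card_product, h2] at h1
      calc (S.card : ℝ) ≤ (R.card : ℝ) * N := by rw [hN]; exact_mod_cast h1
        _ ≤ C₂ * N := by gcongr
    have hSsum : ∑ ρ ∈ S, Φ.wt x₀ (k + 1) ρ ^ d ≤ C₁ * r ^ d := by
      refine hsum (k + 1) S x r hr fun ρ hρ => ?_
      obtain ⟨h1, h2, -⟩ := (Finset.mem_filter.1 hρ).2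
      exact ⟨h1, h2.le⟩
    -- This threshold balances the cardinality term against the volume term.
    set β : ℝ := r * N ^ (-(1 / d : ℝ)) with hβ
    have hβ0 : 0 < β := by positivity
    have hβt : N * β ^ t = N ^ (1 - t / d) * r ^ t := by
      rw [hβ, Real.mul_rpow hr.le (by positivity), ← Real.rpow_mul hN0.le,
        show (1 - t / d : ℝ) = 1 + -(1 / d : ℝ) * t by ring, Real.rpow_add hN0, Real.rpow_one]
      ring
    have hβd : β ^ (t - d) * r ^ d = N ^ (1 - t / d) * r ^ t := by
      rw [hβ, Real.mul_rpow hr.le (by positivity), ← Real.rpow_mul hN0.le,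
        show -(1 / d : ℝ) * (t - d) = 1 - t / d by field_simp; ring, Real.rpow_sub hr,
        Real.rpow_natCast]
      field_simp
    have hmain : ∑ ρ ∈ S, Φ.wt x₀ (k + 1) ρ ^ t ≤
        (C₂ + C₁) * (N ^ (1 - t / d) * r ^ t) := by
      calc ∑ ρ ∈ S, Φ.wt x₀ (k + 1) ρ ^ t
          ≤ ∑ ρ ∈ S, (β ^ t + β ^ (t - d) * Φ.wt x₀ (k + 1) ρ ^ d) := by
            refine Finset.sum_le_sum fun ρ _ => ?_
            have h1 := Real.rpow_le_add_rpow_mul (wt_pos hxV (k + 1) ρ) hβ0 ht htd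
            rwa [Real.rpow_natCast] at h1
        _ = S.card * β ^ t + β ^ (t - d) * ∑ ρ ∈ S, Φ.wt x₀ (k + 1) ρ ^ d := by
            rw [Finset.sum_add_distrib, Finset.sum_const, nsmul_eq_mul, Finset.mul_sum]
        _ ≤ C₂ * N * β ^ t + β ^ (t - d) * (C₁ * r ^ d) := by gcongr
        _ = C₂ * (N * β ^ t) + C₁ * (β ^ (t - d) * r ^ d) := by ring
        _ = _ := by rw [hβt, hβd]; ring
    calc K ^ t * K ^ t * ∑ ρ ∈ S, Φ.wt x₀ (k + 1) ρ ^ t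
        ≤ K ^ t * K ^ t * ((C₂ + C₁) * (N ^ (1 - t / d) * r ^ t)) := by gcongr
      _ = K ^ t * K ^ t * (C₂ + C₁) * (N ^ (1 - t / d) * r ^ t) := by ring
      _ ≤ _ := by gcongr; exact le_max_right _ _

/-- A lower bound for the Hausdorff dimension of the limit set: it suffices to control the mass
that is carried by the words at which the scaling factors fall below a given size. -/
theorem le_dimH_limitSet [NeZero d] (hX : IsPhaseSpace X)
    {x₀ : EuclideanSpace ℝ (Fin d)} (hx₀ : x₀ ∈ X) {W : ℝ} (hW : ∀ n w, Φ.wt x₀ n w ≤ W)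
    (hlim : ∀ r > 0, ∀ᶠ n in atTop, ∀ w, Φ.wt x₀ n w < r)
    {t : ℝ} (ht : 0 ≤ t) (htd : t ≤ d) {s : ℝ≥0} {C q : ℝ} (hq : 0 ≤ q) (hq1 : q < 1)
    (h : ∀ (k : ℕ) (r : ℝ), 0 < r → r ≤ 1 → (∃ u, r ≤ Φ.wt x₀ k u) →
      min (1 / Φ.part x₀ t k)
        ((Nat.card (Φ.I k) : ℝ) ^ (1 - t / d) * r ^ t / Φ.part x₀ t (k + 1)) ≤
          C * q ^ k * r ^ (s : ℝ)) :
    (s : ℝ≥0∞) ≤ dimH Φ.limitSet := by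
  classical
  have hxV := Φ.subset_V hx₀
  have hZ := fun m => part_pos (Φ := Φ) hxV t m
  obtain ⟨C', hC', hmass⟩ := exists_sum_stops_le hX hx₀ hW ht htd
  have hcompact : ∀ n, IsCompact (⋃ w : Φ.Word n, Φ.word n w '' X) := fun n =>
    isCompact_iUnion fun w => hX.isCompact.image_of_continuousOn (continuousOn_word n w)
  rw [limitSet_eq_iInter]
  refine le_dimH_of_mass_ball_le
    (fun n w => Φ.word n w '' X)
    (fun n w => ENNReal.ofReal (Φ.wt x₀ n w ^ t / Φ.part x₀ t n)) ?_
    (fun n w => hX.nonempty.image _) hcompact ?_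
    (C := ENNReal.ofReal (C' * |C| * (1 - q)⁻¹)) ENNReal.ofReal_ne_top ?_
  · intro n
    rw [← ENNReal.ofReal_sum_of_nonneg fun w _ =>
      div_nonneg (Real.rpow_nonneg (wt_nonneg _ _ _) _) (hZ n).le, ← Finset.sum_div]
    change ENNReal.ofReal (Φ.part x₀ t n / Φ.part x₀ t n) = 1
    rw [div_self (hZ n).ne', ENNReal.ofReal_one]
  · refine fun m n hmn => iUnion_subset fun w => ?_
    exact (word_image_subset_take hmn w).trans
      (subset_iUnion (fun u : Φ.Word m => Φ.word m u '' X) (w.take hmn))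
  · intro x r hr hr1
    filter_upwards [hlim r hr] with n hn Q hQ
    rw [← ENNReal.ofReal_sum_of_nonneg fun w _ =>
      div_nonneg (Real.rpow_nonneg (wt_nonneg _ _ _) _) (hZ n).le, ← Finset.sum_div,
      ENNReal.ofReal_rpow_of_pos hr,
      ← ENNReal.ofReal_mul (by have := inv_pos.2 (sub_pos.2 hq1); positivity)]
    refine ENNReal.ofReal_le_ofReal ?_
    rw [div_le_iff₀ (hZ n)]
    -- Every word in `Q` stops at some k < n, and the mass that stops at k is at most geometric in
    -- k.
    let S : ℕ → Finset (Φ.Word n) := fun k =>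
      {w | ∃ h : k + 1 ≤ n, Φ.Stops x₀ (Metric.ball x r) r k (w.take h)}
    have hQS : Q ⊆ (Finset.range n).biUnion S := by
      intro w hw
      obtain ⟨k, hk, hst⟩ := exists_stops_take hr1 w (hn w) (hQ w hw)
      exact Finset.mem_biUnion.2 ⟨k, Finset.mem_range.2 hk,
        Finset.mem_filter.2 ⟨Finset.mem_univ _, hk, hst⟩⟩
    have hwt0 : ∀ w : Φ.Word n, 0 ≤ Φ.wt x₀ n w ^ t := fun w =>
      Real.rpow_nonneg (wt_nonneg _ _ _) _
    have hlevel : ∀ k ∈ Finset.range n, ∑ w ∈ S k, Φ.wt x₀ n w ^ t ≤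
        C' * |C| * r ^ (s : ℝ) * Φ.part x₀ t n * q ^ k := by
      intro k hk
      have hk' : k + 1 ≤ n := Finset.mem_range.1 hk
      have hZn := hZ n
      -- A word that stops at k supplies a prefix of weight at least r, which the hypothesis
      -- requires.
      rcases (S k).eq_empty_or_nonempty with he | ⟨w₀, hw₀⟩
      · rw [he, Finset.sum_empty]
        positivity
      obtain ⟨_, hst⟩ := (Finset.mem_filter.1 hw₀).2
      have h1 := hmass x r hr k n hk' (S k) fun w hw => (Finset.mem_filter.1 hw).2.2
      have h2 := h k r hr hr1 ⟨_, hst.2.2⟩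
      have h3 : C * q ^ k * r ^ (s : ℝ) ≤ |C| * q ^ k * r ^ (s : ℝ) := by
        gcongr; exact le_abs_self C
      calc ∑ w ∈ S k, Φ.wt x₀ n w ^ t ≤ _ := h1
        _ ≤ C' * (|C| * q ^ k * r ^ (s : ℝ)) * Φ.part x₀ t n := by
            gcongr; exact h2.trans h3
        _ = _ := by ring
    have hZn := hZ n
    calc ∑ w ∈ Q, Φ.wt x₀ n w ^ t
        ≤ ∑ w ∈ (Finset.range n).biUnion S, Φ.wt x₀ n w ^ t :=
          Finset.sum_le_sum_of_subset_of_nonneg hQS fun w _ _ => hwt0 w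
      _ ≤ ∑ k ∈ Finset.range n, ∑ w ∈ S k, Φ.wt x₀ n w ^ t :=
          Finset.sum_biUnion_le_of_nonneg _ _ _ hwt0
      _ ≤ ∑ k ∈ Finset.range n, C' * |C| * r ^ (s : ℝ) * Φ.part x₀ t n * q ^ k :=
          Finset.sum_le_sum hlevel
      _ = C' * |C| * r ^ (s : ℝ) * Φ.part x₀ t n * ∑ k ∈ Finset.range n, q ^ k := by
          rw [Finset.mul_sum]
      _ ≤ C' * |C| * r ^ (s : ℝ) * Φ.part x₀ t n * (1 - q)⁻¹ := by
          gcongr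
          rw [← tsum_geometric_of_lt_one hq hq1]
          exact (summable_geometric_of_lt_one hq hq1).sum_le_tsum _ fun k _ => pow_nonneg hq k
      _ = _ := by ring

end NCIFS
end

/-! ### Pressure, partition functions and the upper bound -/

noncomputable section

open MeasureTheory

theorem exists_forall_le_mul_of_eventually {u v : ℕ → ℝ} (hv : ∀ n, 0 < v n)
    (h : ∀ᶠ n in atTop, u n ≤ v n) : ∃ C : ℝ, 0 < C ∧ ∀ n, u n ≤ C * v n := by
  obtain ⟨N, hN⟩ := eventually_atTop.1 h
  have hs : 0 ≤ ∑ k ∈ Finset.range N, |u k| / v k :=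
    Finset.sum_nonneg fun k _ => div_nonneg (abs_nonneg _) (hv k).le
  refine ⟨1 + ∑ k ∈ Finset.range N, |u k| / v k, by linarith, fun n => ?_⟩
  rcases lt_or_ge n N with hn | hn
  · have h1 : |u n| / v n ≤ ∑ k ∈ Finset.range N, |u k| / v k :=
      Finset.single_le_sum (f := fun k => |u k| / v k)
        (fun k _ => div_nonneg (abs_nonneg _) (hv k).le) (Finset.mem_range.2 hn)
    rw [← div_le_iff₀ (hv n)]
    have h2 : u n / v n ≤ |u n| / v n := by
      gcongr
      · exact (hv n).le
      · exact le_abs_self _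
    linarith
  · have h1 := hN n hn
    nlinarith [hv n]

namespace NCIFS

variable {d : ℕ} {X : Set (EuclideanSpace ℝ (Fin d))} {Φ : NCIFS X}

theorem ofReal_wt_le_derivNorm {x : EuclideanSpace ℝ (Fin d)} (hx : x ∈ X) (n : ℕ)
    (w : Φ.Word n) : ENNReal.ofReal (Φ.wt x n w) ≤ derivNorm X (Φ.word n w) := by
  rw [wt, ofReal_norm]
  exact le_iSup₂ (f := fun x (_ : x ∈ X) => ‖fderiv ℝ (Φ.word n w) x‖ₑ) x hx

theorem derivNorm_le_ofReal {K : ℝ} (hK : Φ.HasDistortion K) {x : EuclideanSpace ℝ (Fin d)}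
    (hx : x ∈ X) (n : ℕ) (w : Φ.Word n) :
    derivNorm X (Φ.word n w) ≤ ENNReal.ofReal (K * Φ.wt x n w) := by
  refine iSup₂_le fun y hy => ?_
  rw [← ofReal_norm]
  exact ENNReal.ofReal_le_ofReal (hK.2 n w y (Φ.subset_V hy) x (Φ.subset_V hx))

theorem exists_card_le_of_limsup_lt_top
    (h : limsup (fun n : ℕ => ((Real.log (Nat.card (Φ.I n)) / (n + 1) : ℝ) : EReal)) atTop < ⊤)
    (hfin : ∀ n, Finite (Φ.I n)) :
    ∃ C A : ℝ, 0 < C ∧ 0 ≤ A ∧ ∀ n : ℕ, (Nat.card (Φ.I n) : ℝ) ≤ C * Real.exp (A * n) := by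
  obtain ⟨a, ha, -⟩ := EReal.lt_iff_exists_real_btwn.1 h
  set A := max a 0
  have hev : ∀ᶠ n : ℕ in atTop, (Nat.card (Φ.I n) : ℝ) ≤ Real.exp A * Real.exp (A * n) := by
    filter_upwards [eventually_lt_of_limsup_lt ha] with n hn
    have hn' : Real.log (Nat.card (Φ.I n)) / (n + 1) < a := by exact_mod_cast hn
    have := Φ.nonempty_I n
    have hc : (0 : ℝ) < Nat.card (Φ.I n) := by exact_mod_cast Nat.card_pos
    rw [div_lt_iff₀ (by positivity), Real.log_lt_iff_lt_exp hc] at hn'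
    rw [← Real.exp_add]
    refine hn'.le.trans (Real.exp_le_exp.2 ?_)
    have h1 : a * (n + 1) ≤ A * (n + 1) := by gcongr; exact le_max_left _ _
    linarith
  obtain ⟨C, hC, hall⟩ := exists_forall_le_mul_of_eventually (fun n => by positivity) hev
  exact ⟨C * Real.exp A, A, by positivity, le_max_right _ _, fun n => by
    rw [mul_assoc]; exact hall n⟩

variable [∀ n, Fintype (Φ.I n)]

theorem ofReal_part_le_Z {x : EuclideanSpace ℝ (Fin d)} (hx : x ∈ X) {t : ℝ} (ht : 0 ≤ t)
    (n : ℕ) : ENNReal.ofReal (Φ.part x t n) ≤ Φ.Z n t := by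
  rw [Z, tsum_fintype, part, ENNReal.ofReal_sum_of_nonneg fun w _ =>
    Real.rpow_nonneg (wt_nonneg _ _ _) _]
  refine Finset.sum_le_sum fun w _ => ?_
  rw [← ENNReal.ofReal_rpow_of_nonneg (wt_nonneg _ _ _) ht]
  gcongr
  exact ofReal_wt_le_derivNorm hx n w

theorem Z_le_ofReal_part {K : ℝ} (hK : Φ.HasDistortion K) {x : EuclideanSpace ℝ (Fin d)}
    (hx : x ∈ X) {t : ℝ} (ht : 0 ≤ t) (n : ℕ) :
    Φ.Z n t ≤ ENNReal.ofReal (K ^ t * Φ.part x t n) := by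
  have hK0 : 0 ≤ K := zero_le_one.trans hK.1
  rw [Z, tsum_fintype, part, Finset.mul_sum, ENNReal.ofReal_sum_of_nonneg fun w _ =>
    mul_nonneg (Real.rpow_nonneg hK0 _) (Real.rpow_nonneg (wt_nonneg _ _ _) _)]
  refine Finset.sum_le_sum fun w _ => ?_
  rw [← Real.mul_rpow hK0 (wt_nonneg _ _ _),
    ← ENNReal.ofReal_rpow_of_nonneg (mul_nonneg hK0 (wt_nonneg _ _ _)) ht]
  gcongr
  exact derivNorm_le_ofReal hK hx n w

theorem exists_le_part_of_lowerPressure_pos [NeZero d] {x : EuclideanSpace ℝ (Fin d)} (hx : x ∈ X)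
    {t : ℝ} (ht : 0 ≤ t) (h : 0 < Φ.lowerPressure t) :
    ∃ c δ : ℝ, 0 < c ∧ 0 < δ ∧ ∀ n : ℕ, c * Real.exp (δ * n) ≤ Φ.part x t n := by
  obtain ⟨K, hK⟩ := Φ.exists_hasDistortion
  have hK0 : 0 < K := one_pos.trans_le hK.1
  have hZ := fun n => part_pos (Φ := Φ) (Φ.subset_V hx) t n
  obtain ⟨δ, hδ0, hδ⟩ := EReal.lt_iff_exists_real_btwn.1 h
  have hev : ∀ᶠ n : ℕ in atTop, Real.exp (δ * n) ≤ K ^ t * Φ.part x t n := by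
    filter_upwards [eventually_lt_of_lt_liminf hδ, eventually_gt_atTop 0] with n hn hn0
    have hpos : 0 < K ^ t * Φ.part x t n := mul_pos (by positivity) (hZ n)
    rw [EReal.lt_div_iff (by exact_mod_cast hn0) (EReal.natCast_ne_top n)] at hn
    have h1 := hn.trans_le (ENNReal.log_monotone (Z_le_ofReal_part hK hx ht n))
    rw [ENNReal.log_ofReal, if_neg (not_le.2 hpos)] at h1
    have h2 : δ * n < Real.log (K ^ t * Φ.part x t n) := by exact_mod_cast h1
    exact ((Real.lt_log_iff_exp_lt hpos).1 h2).le
  obtain ⟨C, hC, hall⟩ := exists_forall_le_mul_of_eventually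
    (fun n => mul_pos (by positivity) (hZ n)) hev
  refine ⟨(C * K ^ t)⁻¹, δ, by positivity, by exact_mod_cast hδ0, fun n => ?_⟩
  rw [inv_mul_le_iff₀ (by positivity), mul_assoc]
  exact hall n

theorem frequently_part_le_of_lowerPressure_nonpos [NeZero d] {x : EuclideanSpace ℝ (Fin d)}
    (hx : x ∈ X) {t : ℝ} (ht : 0 ≤ t) (h : ¬ 0 < Φ.lowerPressure t) {ε : ℝ} (hε : 0 < ε) :
    ∃ᶠ n : ℕ in atTop, Φ.part x t n ≤ Real.exp (ε * n) := by
  intro hev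
  apply h
  refine lt_of_lt_of_le (b := (ε : EReal)) (by exact_mod_cast hε) ?_
  refine le_liminf_of_le (by isBoundedDefault) ?_
  filter_upwards [hev, eventually_gt_atTop 0] with n hn hn0
  have hZ := part_pos (Φ := Φ) (Φ.subset_V hx) t n
  rw [EReal.le_div_iff_mul_le (by exact_mod_cast hn0) (EReal.natCast_ne_top n)]
  refine le_trans ?_ (ENNReal.log_monotone (ofReal_part_le_Z hx ht n))
  rw [ENNReal.log_ofReal, if_neg (not_le.2 hZ)]
  have h2 : ε * n ≤ Real.log (Φ.part x t n) :=
    (Real.le_log_iff_exp_le hZ).2 (not_le.1 hn).le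
  exact_mod_cast h2

theorem exists_wt_le_mul_pow {x : EuclideanSpace ℝ (Fin d)} (hx : x ∈ X) :
    ∃ C η : ℝ, 0 < C ∧ 0 < η ∧ η < 1 ∧ ∀ (n : ℕ) (w : Φ.Word n), Φ.wt x n w ≤ C * η ^ n := by
  obtain ⟨η, hη, hη1, M, hM⟩ := Φ.contraction
  have hne : ∀ n, (Finset.univ : Finset (Φ.Word n)).Nonempty := fun n => Finset.univ_nonempty
  -- Contraction gives η^m for words of length m + 1, whence the factor η⁻¹; finiteness of the
  -- alphabets lets a constant absorb the short words.
  have hev : ∀ᶠ n in atTop, Finset.univ.sup' (hne n) (Φ.wt x n) ≤ η⁻¹ * η ^ n := by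
    filter_upwards [eventually_ge_atTop (M + 1)] with n hn
    obtain ⟨m, rfl⟩ : ∃ m, n = m + 1 := ⟨n - 1, by omega⟩
    refine Finset.sup'_le _ _ fun w _ => ?_
    rw [pow_succ, mul_comm, mul_assoc, mul_inv_cancel₀ hη.ne', mul_one]
    exact hM m (by omega) 0 w x hx
  obtain ⟨C, hC, h⟩ := exists_forall_le_mul_of_eventually (fun n => by positivity) hev
  refine ⟨C * η⁻¹, η, by positivity, hη, hη1, fun n w => ?_⟩
  rw [mul_assoc]
  exact (Finset.le_sup' (Φ.wt x n) (Finset.mem_univ w)).trans (h n)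

theorem part_le_mul_part {x : EuclideanSpace ℝ (Fin d)} {n : ℕ} {b : ℝ}
    (hb : ∀ w : Φ.Word n, Φ.wt x n w ≤ b) {t t' : ℝ} (htt : t' ≤ t)
    (hpos : ∀ w : Φ.Word n, 0 < Φ.wt x n w) :
    Φ.part x t n ≤ b ^ (t - t') * Φ.part x t' n := by
  rw [part, part, Finset.mul_sum]
  refine Finset.sum_le_sum fun w _ => ?_
  have h1 : Φ.wt x n w ^ t = Φ.wt x n w ^ (t - t') * Φ.wt x n w ^ t' := by
    rw [← Real.rpow_add (hpos w)]; congr 1; ring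
  rw [h1]
  exact mul_le_mul_of_nonneg_right
    (Real.rpow_le_rpow (wt_nonneg _ _ _) (hb w) (sub_nonneg.2 htt))
    (Real.rpow_nonneg (wt_nonneg _ _ _) _)

/-- For B < t' < t, the partition function at t' is at most exp(εn) infinitely often, and passing to
t gains η^((t-t')n). Bounded sums along a subsequence suffice for finite Hausdorff measure. -/
theorem dimH_limitSet_le_bowenDim [NeZero d] (hX : IsCompact X) (hne : X.Nonempty) :
    dimH Φ.limitSet ≤ Φ.bowenDim := by
  obtain ⟨x, hx⟩ := hne
  have hpos := fun n (w : Φ.Word n) => wt_pos (Φ.subset_V hx) n w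
  obtain ⟨K, hK⟩ := Φ.exists_hasDistortion
  obtain ⟨C₁, hC₁, hdist⟩ := exists_dist_word_le hX hK
  obtain ⟨C, η, hC, hη, hη1, hwt⟩ := exists_wt_le_mul_pow (Φ := Φ) hx
  refine le_of_forall_gt_imp_ge_of_dense fun a ha => ?_
  induction a with
  | top => exact le_top
  | coe t =>
  obtain ⟨t', ht'B, ht't⟩ := ENNReal.lt_iff_exists_nnreal_btwn.1 ha
  have htt : (t' : ℝ) < t := by exact_mod_cast ht't
  have hP : ¬ 0 < Φ.lowerPressure t' := fun h =>
    absurd (le_iSup₂ (f := fun (s : ℝ≥0) (_ : 0 < Φ.lowerPressure s) => (s : ℝ≥0∞)) t' h)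
      (not_le.2 ht'B)
  -- Exactly the rate that the gain η^((t-t')n) compensates.
  set ε : ℝ := (t - t') * -Real.log η with hε
  have hε0 : 0 < ε := mul_pos (by linarith) (neg_pos.2 (Real.log_neg hη hη1))
  have hfreq := frequently_part_le_of_lowerPressure_nonpos hx t'.2 hP hε0
  have hediam : ∀ n (w : Φ.Word n),
      Metric.ediam (Φ.word n w '' X) ≤ ENNReal.ofReal (C₁ * Φ.wt x n w) := by
    intro n w
    refine Metric.ediam_le ?_
    rintro _ ⟨y, hy, rfl⟩ _ ⟨z, hz, rfl⟩
    rw [edist_dist]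
    exact ENNReal.ofReal_le_ofReal (hdist x hx n w y hy z hz)
  borelize (EuclideanSpace ℝ (Fin d))
  refine dimH_le_of_hausdorffMeasure_ne_top ?_
  have hle := Measure.hausdorffMeasure_le_liminf_sum (t : ℝ) Φ.limitSet (l := atTop)
    (fun n => ENNReal.ofReal (C₁ * (C * η ^ n))) (by
      rw [← ENNReal.ofReal_zero]
      refine ENNReal.tendsto_ofReal ?_
      have := ((tendsto_pow_atTop_nhds_zero_of_lt_one hη.le hη1).const_mul C).const_mul C₁
      simpa using this)
    (fun n (w : Φ.Word n) => Φ.word n w '' X)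
    (Eventually.of_forall fun n w => (hediam n w).trans
      (ENNReal.ofReal_le_ofReal (by gcongr; exact hwt n w)))
    (Eventually.of_forall fun n => by
      rw [limitSet_eq_iInter]; exact iInter_subset _ n)
  refine ((hle.trans (liminf_le_of_frequently_le' ?_)).trans_lt
    (ENNReal.ofReal_lt_top (r := C₁ ^ (t : ℝ) * C ^ (t - t' : ℝ)))).ne
  refine hfreq.mono fun n hn => ?_
  have hpart : Φ.part x t n ≤ C ^ (t - t' : ℝ) := by
    refine (part_le_mul_part (hwt n) htt.le (hpos n)).trans ?_
    have h1 : (C * η ^ n) ^ (t - t' : ℝ) = C ^ (t - t' : ℝ) * Real.exp (-(ε * n)) := by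
      rw [Real.mul_rpow hC.le (by positivity)]
      congr 1
      rw [Real.rpow_def_of_pos (by positivity), Real.log_pow, hε]
      congr 1; ring
    rw [h1, mul_assoc]
    refine mul_le_of_le_one_right (by positivity) ?_
    calc Real.exp (-(ε * n)) * Φ.part x t' n ≤ Real.exp (-(ε * n)) * Real.exp (ε * n) := by
          gcongr; exact hn
      _ = 1 := by rw [← Real.exp_add, neg_add_cancel, Real.exp_zero]
  calc ∑ w, Metric.ediam (Φ.word n w '' X) ^ (t : ℝ)
      ≤ ∑ w, ENNReal.ofReal (C₁ ^ (t : ℝ) * Φ.wt x n w ^ (t : ℝ)) := by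
        refine Finset.sum_le_sum fun w _ => ?_
        rw [← Real.mul_rpow hC₁.le (wt_nonneg _ _ _),
          ← ENNReal.ofReal_rpow_of_nonneg (mul_nonneg hC₁.le (wt_nonneg _ _ _)) t.coe_nonneg]
        gcongr
        exact hediam n w
    _ = ENNReal.ofReal (C₁ ^ (t : ℝ) * Φ.part x t n) := by
        rw [← ENNReal.ofReal_sum_of_nonneg fun w _ =>
          mul_nonneg (by positivity) (Real.rpow_nonneg (wt_nonneg _ _ _) _), ← Finset.mul_sum, part]
    _ ≤ _ := by gcongr

/-- By volume, the partition function at d is bounded, hence so is the one at any larger exponent,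
which excludes exponential growth. -/
theorem le_of_lowerPressure_pos [NeZero d] (hX : IsPhaseSpace X) {t : ℝ}
    (ht : 0 ≤ t) (h : 0 < Φ.lowerPressure t) : t ≤ d := by
  by_contra! hdt
  obtain ⟨x, hx⟩ := hX.nonempty
  have hpos := fun n (w : Φ.Word n) => wt_pos (Φ.subset_V hx) n w
  obtain ⟨C₁, hC₁, hsum⟩ := exists_sum_wt_pow_le (Φ := Φ) hX.isCompact hX.interior_nonempty hx
  obtain ⟨C, η, hC, hη, hη1, hwt⟩ := exists_wt_le_mul_pow (Φ := Φ) hx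
  obtain ⟨c, δ, hc, hδ, hpart⟩ := exists_le_part_of_lowerPressure_pos hx ht h
  have hwC : ∀ n (w : Φ.Word n), Φ.wt x n w ≤ C := fun n w =>
    (hwt n w).trans (mul_le_of_le_one_right hC.le (pow_le_one₀ hη.le hη1.le))
  obtain ⟨D, hD⟩ := hX.isCompact.isBounded.subset_ball x
  have hbound : ∀ n : ℕ, c * Real.exp (δ * n) ≤ C ^ (t - d) * (C₁ * max C D ^ d) := by
    intro n
    refine (hpart n).trans ((part_le_mul_part (hwC n) hdt.le (hpos n)).trans ?_)
    gcongr
    have := hsum n Finset.univ x (max C D) (lt_max_of_lt_left hC) fun w _ =>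
      ⟨⟨_, mem_image_of_mem _ hx, Metric.ball_subset_ball (le_max_right _ _)
        (hD (word_mapsTo n w hx))⟩, (hwC n w).trans (le_max_left _ _)⟩
    simpa only [part, Real.rpow_natCast] using this
  have htend : Tendsto (fun n : ℕ => c * Real.exp (δ * n)) atTop atTop :=
    (Real.tendsto_exp_atTop.comp
      (tendsto_natCast_atTop_atTop.const_mul_atTop hδ)).const_mul_atTop hc
  obtain ⟨n, hn⟩ := (htend.eventually_gt_atTop (C ^ (t - d) * (C₁ * max C D ^ d))).exists
  exact absurd (hbound n) (not_le.2 hn)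

theorem bowenDim_le [NeZero d] (hX : IsPhaseSpace X) : Φ.bowenDim ≤ (d : ℝ≥0∞) := by
  refine iSup₂_le fun t ht => ?_
  have h : (t : ℝ) ≤ d := le_of_lowerPressure_pos hX t.2 ht
  exact_mod_cast h

end NCIFS
end

/-! ### Lower bounds for the dimension in the three cases -/

noncomputable section

open MeasureTheory

theorem min_le_rpow_mul_rpow {a b θ : ℝ} (ha : 0 < a) (hb : 0 < b) (hθ : 0 ≤ θ) (hθ1 : θ ≤ 1) :
    min a b ≤ a ^ (1 - θ) * b ^ θ := by
  have hm : 0 < min a b := lt_min ha hb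
  calc min a b = min a b ^ (1 - θ) * min a b ^ θ := by
        rw [← Real.rpow_add hm, sub_add_cancel, Real.rpow_one]
    _ ≤ a ^ (1 - θ) * b ^ θ := by
        exact mul_le_mul (Real.rpow_le_rpow hm.le (min_le_left _ _) (sub_nonneg.2 hθ1))
          (Real.rpow_le_rpow hm.le (min_le_right _ _) hθ) (by positivity) (by positivity)

namespace NCIFS

variable {d : ℕ} {X : Set (EuclideanSpace ℝ (Fin d))} {Φ : NCIFS X} [∀ n, Fintype (Φ.I n)]

theorem le_dimH_limitSet_of_exp [NeZero d] (hX : IsPhaseSpace X)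
    {x₀ : EuclideanSpace ℝ (Fin d)} (hx₀ : x₀ ∈ X)
    {t : ℝ} (ht : 0 ≤ t) (htd : t ≤ d) {s : ℝ≥0} {C δ : ℝ} (hδ : 0 < δ)
    (h : ∀ (k : ℕ) (r : ℝ), 0 < r → r ≤ 1 → (∃ u, r ≤ Φ.wt x₀ k u) →
      min (1 / Φ.part x₀ t k)
        ((Nat.card (Φ.I k) : ℝ) ^ (1 - t / d) * r ^ t / Φ.part x₀ t (k + 1)) ≤
          C * Real.exp (-(δ * k)) * r ^ (s : ℝ)) :
    (s : ℝ≥0∞) ≤ dimH Φ.limitSet := by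
  obtain ⟨C', η, hC', hη, hη1, hwt⟩ := exists_wt_le_mul_pow (Φ := Φ) hx₀
  refine le_dimH_limitSet hX hx₀ (W := C') (fun n w => (hwt n w).trans
    (mul_le_of_le_one_right hC'.le (pow_le_one₀ hη.le hη1.le))) ?_ ht htd
    (Real.exp_pos (-δ)).le (Real.exp_lt_one_iff.2 (neg_neg_of_pos hδ)) (C := C) ?_
  · intro r hr
    have hlim : Tendsto (fun n => C' * η ^ n) atTop (𝓝 0) := by
      simpa using (tendsto_pow_atTop_nhds_zero_of_lt_one hη.le hη1).const_mul C'
    filter_upwards [hlim.eventually_lt_const hr] with n hn w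
    exact (hwt n w).trans_lt hn
  · intro k r hr hr1 hu
    refine (h k r hr hr1 hu).trans_eq ?_
    rw [← Real.exp_nat_mul]
    congr 3
    ring

theorem card_rpow_le {C A : ℝ} (hN : ∀ n : ℕ, (Nat.card (Φ.I n) : ℝ) ≤ C * Real.exp (A * n))
    {p : ℝ} (hp : p ≤ 1) (k : ℕ) : (Nat.card (Φ.I k) : ℝ) ^ p ≤ C * Real.exp (A * k) := by
  have := Φ.nonempty_I k
  have h1 : (1 : ℝ) ≤ Nat.card (Φ.I k) := by exact_mod_cast Nat.card_pos
  refine (Real.rpow_le_rpow_of_exponent_le h1 hp).trans ?_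
  rw [Real.rpow_one]
  exact hN k

theorem exists_wt_le_exp_of_smallPieces [NeZero d] {x : EuclideanSpace ℝ (Fin d)} (hx : x ∈ X)
    (hΦ : Φ.SmallPieces) {L : ℝ} (hL : 0 ≤ L) :
    ∃ C : ℝ, 0 < C ∧ ∀ (n : ℕ) (w : Φ.Word n), Φ.wt x n w ≤ C * Real.exp (-(L * n)) := by
  obtain ⟨K, hK⟩ := Φ.exists_hasDistortion
  have hK0 : 0 < K := one_pos.trans_le hK.1
  obtain ⟨W, η, hW, hη, hη1, hwt⟩ := exists_wt_le_mul_pow (Φ := Φ) hx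
  -- Each new symbol moves the base point of the shorter word, at the cost of a factor K; dividing
  -- by K leaves a net factor exp(-L).
  have hε : 0 < Real.exp (-L) / K := by positivity
  obtain ⟨n₀, hn₀⟩ := eventually_atTop.1
    (hΦ.eventually_lt_const (ENNReal.ofReal_pos.2 hε))
  have hsmall : ∀ n ≥ n₀, ∀ i : Φ.I n, ‖fderiv ℝ (Φ.map n i) x‖ ≤ Real.exp (-L) / K := by
    intro n hn i
    have h1 : ‖fderiv ℝ (Φ.map n i) x‖ₑ ≤ ⨆ i, derivNorm X (Φ.map n i) :=
      (le_iSup₂ (f := fun x (_ : x ∈ X) => ‖fderiv ℝ (Φ.map n i) x‖ₑ) x hx).trans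
        (le_iSup (fun i => derivNorm X (Φ.map n i)) i)
    have h2 := h1.trans (hn₀ n hn).le
    rwa [← ofReal_norm, ENNReal.ofReal_le_ofReal_iff hε.le] at h2
  refine ⟨W * Real.exp (L * n₀), by positivity, fun n => ?_⟩
  have hbase : ∀ m ≤ n₀, ∀ w : Φ.Word m,
      Φ.wt x m w ≤ W * Real.exp (L * n₀) * Real.exp (-(L * m)) := by
    intro m hm w
    refine (hwt m w).trans ?_
    rw [mul_assoc]
    gcongr
    refine (pow_le_one₀ hη.le hη1.le).trans ?_
    rw [← Real.exp_add]
    refine Real.one_le_exp ?_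
    have : L * m ≤ L * n₀ := by gcongr
    linarith
  induction n with
  | zero => exact hbase 0 (Nat.zero_le _)
  | succ n ih =>
    intro w
    rcases le_or_gt (n + 1) n₀ with hn | hn
    · exact hbase _ hn w
    · have hxV := Φ.subset_V hx
      rw [wt_succ hxV]
      have h1 := hK.2 n w.init _ (Φ.mapsTo_V (0 + n) (w (Fin.last n)) hxV) x hxV
      have h2 := hsmall (0 + n) (by omega) (w (Fin.last n))
      calc _ ≤ K * Φ.wt x n w.init * (Real.exp (-L) / K) :=
            mul_le_mul h1 h2 (norm_nonneg _) (mul_nonneg hK0.le (wt_nonneg _ _ _))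
        _ = Φ.wt x n w.init * Real.exp (-L) := by field_simp
        _ ≤ W * Real.exp (L * n₀) * Real.exp (-(L * n)) * Real.exp (-L) := by
            gcongr; exact ih w.init
        _ = _ := by
            rw [mul_assoc, ← Real.exp_add]
            congr 2
            push_cast; ring

/-- Lowering the exponent from t' to a divides each term by a positive power of a superexponentially
small weight. The partition function then beats exp(Ak), and the second bound of the minimum
suffices. -/
theorem bowenDim_le_dimH_of_smallPieces [NeZero d] (hX : IsPhaseSpace X) {C A : ℝ} (hC : 0 < C)
    (hA : 0 ≤ A) (hN : ∀ n : ℕ, (Nat.card (Φ.I n) : ℝ) ≤ C * Real.exp (A * n))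
    (hΦ : Φ.SmallPieces) : Φ.bowenDim ≤ dimH Φ.limitSet := by
  obtain ⟨x, hx⟩ := hX.nonempty
  have hxV := Φ.subset_V hx
  have hd0 : (0 : ℝ) < d := by exact_mod_cast Nat.pos_of_neZero d
  refine iSup₂_le fun t' ht' => le_of_forall_lt_imp_le_of_dense fun a ha => ?_
  lift a to ℝ≥0 using ha.ne_top
  have hat : (a : ℝ) < t' := by exact_mod_cast ha
  have ht'd := le_of_lowerPressure_pos hX t'.2 ht'
  obtain ⟨c, δ, hc, hδ, hpart⟩ := exists_le_part_of_lowerPressure_pos hx t'.2 ht'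
  set b : ℝ := t' - a with hb
  have hb0 : 0 < b := sub_pos.2 hat
  -- This rate makes the gain exp((A + 1)n), one unit more than the alphabets can consume.
  obtain ⟨D, hD, hwt⟩ := exists_wt_le_exp_of_smallPieces hx hΦ
    (L := (A + 1) / b) (by positivity)
  have hlow : ∀ n : ℕ, c * D ^ (-b) * Real.exp ((A + 1) * n) ≤ Φ.part x a n := by
    intro n
    have h1 := part_le_mul_part (hwt n) hat.le (fun w => wt_pos hxV n w)
    have h2 : (D * Real.exp (-((A + 1) / b * n))) ^ (t' - a : ℝ) =
        D ^ b * Real.exp (-((A + 1) * n)) := by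
      rw [← hb, Real.mul_rpow hD.le (Real.exp_pos _).le, ← Real.exp_mul]
      congr 2
      field_simp
    rw [h2] at h1
    have h3 : c ≤ Φ.part x t' n := by
      refine le_trans ?_ (hpart n)
      exact le_mul_of_one_le_right hc.le (Real.one_le_exp (by positivity))
    have h4 := h3.trans h1
    have hDb : 0 < D ^ b := Real.rpow_pos_of_pos hD b
    calc c * D ^ (-b) * Real.exp ((A + 1) * n)
        ≤ D ^ b * Real.exp (-((A + 1) * n)) * Φ.part x a n * D ^ (-b) *
          Real.exp ((A + 1) * n) := by gcongr
      _ = Φ.part x a n := by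
          rw [Real.rpow_neg hD.le, Real.exp_neg]
          field_simp
  refine le_dimH_limitSet_of_exp hX hx (t := a) a.2 (hat.le.trans ht'd) one_pos
    (C := C / (c * D ^ (-b))) ?_
  intro k r hr hr1 _
  refine (min_le_right _ _).trans ?_
  have hp : (1 - a / d : ℝ) ≤ 1 := by
    have : (0 : ℝ) ≤ a / d := by positivity
    linarith
  have h1 := card_rpow_le hN hp k
  have h2 := hlow (k + 1)
  have h3 : c * D ^ (-b) * Real.exp ((A + 1) * k) ≤ Φ.part x a (k + 1) := by
    refine le_trans ?_ h2
    gcongr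
    exact Nat.le_succ k
  calc (Nat.card (Φ.I k) : ℝ) ^ (1 - a / d : ℝ) * r ^ (a : ℝ) / Φ.part x a (k + 1)
      ≤ C * Real.exp (A * k) * r ^ (a : ℝ) / (c * D ^ (-b) * Real.exp ((A + 1) * k)) := by
        gcongr
    _ = C / (c * D ^ (-b)) * (Real.exp (A * k) / Real.exp ((A + 1) * k)) * r ^ (a : ℝ) := by
        field_simp
    _ = _ := by
        rw [← Real.exp_sub]
        congr 3
        ring

/-- The first bound decays in k but carries no power of r; the second has r^t but may grow like
exp(Ak). A geometric mean with a small weight θ on the second keeps some of both, and gives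
dimension at least tθ. -/
theorem dimH_pos_of_lowerPressure_pos [NeZero d] (hX : IsPhaseSpace X) {C A : ℝ} (hC : 0 < C)
    (hA : 0 ≤ A) (hN : ∀ n : ℕ, (Nat.card (Φ.I n) : ℝ) ≤ C * Real.exp (A * n))
    {t : ℝ≥0} (ht0 : 0 < t) (ht : 0 < Φ.lowerPressure t) : 0 < dimH Φ.limitSet := by
  obtain ⟨x, hx⟩ := hX.nonempty
  have hxV := Φ.subset_V hx
  have hZ := fun n => part_pos (Φ := Φ) hxV t n
  have htd := le_of_lowerPressure_pos hX t.2 ht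
  obtain ⟨c, δ, hc, hδ, hpart⟩ := exists_le_part_of_lowerPressure_pos hx t.2 ht
  -- Then -δ(1 - θ) + Aθ = -δ/2.
  set θ : ℝ := δ / (2 * (A + δ)) with hθ
  have hθ0 : 0 < θ := by positivity
  have hθ1 : θ ≤ 1 := (div_le_one (by positivity)).2 (by linarith)
  have hs : 0 < t * θ.toNNReal := mul_pos ht0 (Real.toNNReal_pos.2 hθ0)
  refine lt_of_lt_of_le (ENNReal.coe_pos.2 hs) ?_
  refine le_dimH_limitSet_of_exp hX hx t.2 htd (δ := δ / 2) (by positivity)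
    (C := (1 / c) ^ (1 - θ) * (C / c) ^ θ) ?_
  intro k r hr hr1 _
  have := Φ.nonempty_I k
  have hcard : (0 : ℝ) < Nat.card (Φ.I k) := by exact_mod_cast Nat.card_pos
  have hZ1 := hZ (k + 1)
  refine (min_le_rpow_mul_rpow (one_div_pos.2 (hZ k)) (by positivity) hθ0.le hθ1).trans ?_
  have ha : 1 / Φ.part x t k ≤ 1 / c * Real.exp (-(δ * k)) := by
    rw [Real.exp_neg, ← div_eq_mul_inv, div_div]
    exact one_div_le_one_div_of_le (by positivity) (hpart k)
  have hp : (1 - t / d : ℝ) ≤ 1 := by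
    have : (0 : ℝ) ≤ t / d := by positivity
    linarith
  have hb : (Nat.card (Φ.I k) : ℝ) ^ (1 - t / d : ℝ) * r ^ (t : ℝ) / Φ.part x t (k + 1) ≤
      C / c * Real.exp (A * k) * r ^ (t : ℝ) := by
    have h1 : c ≤ Φ.part x t (k + 1) := by
      refine le_trans ?_ (hpart (k + 1))
      exact le_mul_of_one_le_right hc.le (Real.one_le_exp (by positivity))
    have h2 := card_rpow_le hN hp k
    calc _ ≤ C * Real.exp (A * k) * r ^ (t : ℝ) / c := by gcongr
      _ = _ := by ring
  have hone : 0 ≤ 1 - θ := by linarith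
  have hpZ := hZ k
  calc _ ≤ (1 / c * Real.exp (-(δ * k))) ^ (1 - θ) *
        (C / c * Real.exp (A * k) * r ^ (t : ℝ)) ^ θ := by
        gcongr
        exact hb
    _ = (1 / c) ^ (1 - θ) * (C / c) ^ θ *
        (Real.exp (-(δ * k) * (1 - θ)) * Real.exp (A * k * θ)) * r ^ (t * θ : ℝ) := by
        rw [Real.mul_rpow (by positivity) (by positivity),
          Real.mul_rpow (by positivity) (by positivity),
          Real.mul_rpow (by positivity) (by positivity), ← Real.exp_mul, ← Real.exp_mul,
          ← Real.rpow_mul hr.le]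
        ring
    _ = _ := by
        rw [← Real.exp_add, NNReal.coe_mul, Real.coe_toNNReal θ hθ0.le]
        congr 3
        rw [hθ]
        field_simp
        ring

/-- The relevant k satisfy r ≤ D η^k, so exp(Ak) is at most a constant times r^(-A/κ) with κ = -log
η. Raised to the power 1 - t/d, this costs an exponent that vanishes as t tends to d. -/
theorem le_dimH_of_bowenDim_eq [NeZero d] (hX : IsPhaseSpace X) {C A : ℝ} (hC : 0 < C)
    (hA : 0 ≤ A) (hN : ∀ n : ℕ, (Nat.card (Φ.I n) : ℝ) ≤ C * Real.exp (A * n))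
    (hΦ : Φ.bowenDim = (d : ℝ≥0∞)) : (d : ℝ≥0∞) ≤ dimH Φ.limitSet := by
  obtain ⟨x, hx⟩ := hX.nonempty
  have hxV := Φ.subset_V hx
  have hd0 : (0 : ℝ) < d := by exact_mod_cast Nat.pos_of_neZero d
  obtain ⟨D, η, hD, hη, hη1, hwt⟩ := exists_wt_le_mul_pow (Φ := Φ) hx
  set κ : ℝ := -Real.log η with hκ
  have hκ0 : 0 < κ := neg_pos.2 (Real.log_neg hη hη1)
  set a : ℝ := A / κ with ha
  have ha0 : 0 ≤ a := by positivity
  refine le_of_forall_lt_imp_le_of_dense fun s hs => ?_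
  lift s to ℝ≥0 using hs.ne_top
  have hsd : (s : ℝ) < d := by exact_mod_cast hs
  obtain ⟨t, ht, hst⟩ : ∃ t : ℝ≥0, 0 < Φ.lowerPressure t ∧ (s : ℝ) ≤ t - a * (1 - t / d) := by
    -- The number on the left is the solution t of t - a(1 - t/d) = s; it is below d because s is.
    have h1 : ENNReal.ofReal ((s + a) / (1 + a / d)) < Φ.bowenDim := by
      rw [hΦ, ← ENNReal.ofReal_natCast, ENNReal.ofReal_lt_ofReal_iff hd0,
        div_lt_iff₀ (by positivity)]
      have : d * (1 + a / d) = d + a := by field_simp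
      linarith
    obtain ⟨t, ht, hlt⟩ := by
      simpa only [bowenDim, lt_iSup_iff, exists_prop] using h1
    refine ⟨t, ht, ?_⟩
    have h2 : (s + a) / (1 + a / d) < t := by
      rw [← ENNReal.ofReal_coe_nnreal] at hlt
      exact (ENNReal.ofReal_lt_ofReal_iff_of_nonneg (by positivity)).1 hlt
    rw [div_lt_iff₀ (by positivity)] at h2
    have h3 : (t : ℝ) * (1 + a / d) = t + a * (t / d) := by ring
    linarith
  have htd := le_of_lowerPressure_pos hX t.2 ht
  obtain ⟨c, δ, hc, hδ, hpart⟩ := exists_le_part_of_lowerPressure_pos hx t.2 ht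
  have hp0 : (0 : ℝ) ≤ 1 - t / d := sub_nonneg.2 ((div_le_one hd0).2 htd)
  set σ : ℝ := a * (1 - t / d) with hσ
  have hσ0 : 0 ≤ σ := by positivity
  refine le_dimH_limitSet_of_exp hX hx t.2 htd hδ
    (C := C ^ (1 - t / d : ℝ) * D ^ σ / c) ?_
  rintro k r hr hr1 ⟨u, hu⟩
  refine (min_le_right _ _).trans ?_
  have hexp : Real.exp (κ * k) ≤ D / r := by
    have h1 := hu.trans (hwt k u)
    have h2 : η ^ k = Real.exp (-(κ * k)) := by
      rw [← Real.rpow_natCast, Real.rpow_def_of_pos hη, hκ]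
      congr 1; ring
    rw [h2, Real.exp_neg, ← div_eq_mul_inv, le_div_iff₀ (Real.exp_pos _)] at h1
    rw [le_div_iff₀ hr]
    linarith
  have hcard : (Nat.card (Φ.I k) : ℝ) ^ (1 - t / d : ℝ) ≤
      C ^ (1 - t / d : ℝ) * (D ^ σ / r ^ σ) := by
    calc (Nat.card (Φ.I k) : ℝ) ^ (1 - t / d : ℝ)
        ≤ (C * Real.exp (A * k)) ^ (1 - t / d : ℝ) := by gcongr; exact hN k
      _ = C ^ (1 - t / d : ℝ) * Real.exp (κ * k) ^ σ := by
          rw [Real.mul_rpow hC.le (Real.exp_pos _).le, ← Real.exp_mul, ← Real.exp_mul, hσ, ha]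
          congr 2
          field_simp
      _ ≤ C ^ (1 - t / d : ℝ) * (D / r) ^ σ := by gcongr
      _ = _ := by rw [Real.div_rpow hD.le hr.le]
  have hpk : c * Real.exp (δ * k) ≤ Φ.part x t (k + 1) := by
    refine le_trans ?_ (hpart (k + 1))
    gcongr
    exact Nat.le_succ k
  calc _ ≤ C ^ (1 - t / d : ℝ) * (D ^ σ / r ^ σ) * r ^ (t : ℝ) / (c * Real.exp (δ * k)) :=
        div_le_div₀ (by positivity) (mul_le_mul_of_nonneg_right hcard (by positivity))
          (by positivity) hpk
    _ = C ^ (1 - t / d : ℝ) * D ^ σ / c * Real.exp (-(δ * k)) * r ^ (t - σ : ℝ) := by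
        rw [Real.exp_neg, Real.rpow_sub hr]
        field_simp
    _ ≤ _ := by
        gcongr C ^ (1 - t / d : ℝ) * D ^ σ / c * Real.exp (-(δ * k)) * ?_
        exact Real.rpow_le_rpow_of_exponent_ge hr hr1 hst

theorem bowenFormula_of_exponential_growth [NeZero d] (hX : IsPhaseSpace X)
    (h : limsup (fun n : ℕ => ((Real.log (Nat.card (Φ.I n)) / (n + 1) : ℝ) : EReal)) atTop < ⊤)
    (hΦ : Φ.SmallPieces ∨ dimH Φ.limitSet = 0 ∨ Φ.bowenDim = (d : ℝ≥0∞)) :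
    Φ.BowenFormula := by
  obtain ⟨C, A, hC, hA, hN⟩ := exists_card_le_of_limsup_lt_top h fun _ => inferInstance
  refine le_antisymm (dimH_limitSet_le_bowenDim hX.isCompact hX.nonempty) ?_
  rcases hΦ with h1 | h2 | h3
  · exact bowenDim_le_dimH_of_smallPieces hX hC hA hN h1
  · rw [h2]
    refine iSup₂_le fun t ht => ?_
    by_contra! ht0
    exact (dimH_pos_of_lowerPressure_pos hX hC hA hN (ENNReal.coe_pos.1 ht0) ht).ne' h2
  · rw [h3]
    exact le_dimH_of_bowenDim_eq hX hC hA hN h3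

end NCIFS
end

/-! ### Scale sequences and homotheties for the counterexample -/

noncomputable section

open MeasureTheory

section SlowSequences

/-- Take the largest m ≤ n with g m ≤ f k for all k ≥ n; asking for all later k makes the choice
monotone. -/
theorem exists_slow_sequence {f g : ℕ → ℝ} (hf : Tendsto f atTop atTop) (h0 : ∀ n, g 0 ≤ f n) :
    ∃ a : ℕ → ℕ, Monotone a ∧ Tendsto a atTop atTop ∧ ∀ n, g (a n) ≤ f n := by
  classical
  refine ⟨fun n => Nat.findGreatest (fun m => ∀ k ≥ n, g m ≤ f k) n, ?_, ?_, ?_⟩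
  · intro m n hmn
    exact Nat.findGreatest_mono (fun i hi k hk => hi k (hmn.trans hk)) hmn
  · refine tendsto_atTop.2 fun m => ?_
    obtain ⟨N, hN⟩ := eventually_atTop.1 (hf.eventually_ge_atTop (g m))
    filter_upwards [eventually_ge_atTop N, eventually_ge_atTop m] with n hn hm
    exact Nat.le_findGreatest hm fun k hk => hN k (hn.trans hk)
  · intro n
    exact Nat.findGreatest_spec (P := fun m => ∀ k ≥ n, g m ≤ f k) (Nat.zero_le n)
      (fun k _ => h0 k) n le_rfl

/-- Partial sums of a sequence that makes a large jump whenever the sum so far is small. -/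
def jumpSum (a : ℕ → ℕ) : ℕ → ℕ
  | 0 => 0
  | n + 1 => jumpSum a n +
      if jumpSum a n ≤ 2 * (n + 1) * a n then (n + 1) * (a n ^ 3 - a n ^ 2) else a n

/-- Without jumps after N, the sum increases only by `a n` at each step, hence by at most n · `a n`,
and drops below the threshold again. -/
theorem frequently_jumpSum_le {a : ℕ → ℕ} (ha : Monotone a) (ha' : Tendsto a atTop atTop) :
    ∃ᶠ n in atTop, jumpSum a n ≤ 2 * (n + 1) * a n := by
  intro hev
  obtain ⟨N, hN⟩ := eventually_atTop.1 hev
  have hgrow : ∀ n ≥ N, jumpSum a n ≤ jumpSum a N + n * a n := by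
    intro n hn
    induction n, hn using Nat.le_induction with
    | base => exact Nat.le_add_right _ _
    | succ n hn ih =>
      rw [jumpSum, if_neg (hN n hn)]
      have h1 : (n + 1) * a n ≤ (n + 1) * a (n + 1) := Nat.mul_le_mul_left _ (ha n.le_succ)
      have h2 : (n + 1) * a n = n * a n + a n := by ring
      omega
  obtain ⟨n, hn1, hn2, hn3⟩ := ((ha'.eventually_ge_atTop 1).and
    ((eventually_ge_atTop N).and (eventually_ge_atTop (jumpSum a N)))).exists
  have h1 := hgrow n hn2
  have h2 := not_le.1 (hN n hn2)
  have h3 : n * 1 ≤ n * a n := Nat.mul_le_mul_left n hn1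
  have h4 : 2 * (n + 1) * a n = n * a n + n * a n + 2 * a n := by ring
  omega

/-- At a jump, l = (n+1)a³ and l - h = (n+1)a². The gap is a fraction 1/a of l, yet at least a/2
times the preceding sum, which the jump condition bounds by 2(n+1)a. Elsewhere h = l = a. The
sequence a tends to infinity so slowly that `α` accommodates (n+1)a³. -/
theorem exists_jump_sequences (d : ℕ) {α : ℕ → ℕ} (hα0 : ∀ n, 0 < α n)
    (hα : Tendsto (fun n : ℕ => Real.log (α n) / (n + 1)) atTop atTop) :
    ∃ h l : ℕ → ℕ, (∀ n, (2 ^ h n) ^ d ≤ α n) ∧ (∀ n, h n ≤ l n) ∧ Tendsto l atTop atTop ∧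
      (∀ ε : ℝ, 0 < ε → ∀ᶠ n in atTop, (l n - h n : ℝ) ≤ ε * l n) ∧
      ∀ M : ℝ, 0 ≤ M → ∃ᶠ n in atTop, M * ∑ j ∈ Finset.range n, (h j : ℝ) ≤ l n - h n := by
  obtain ⟨a, ha, ha', hlog⟩ := exists_slow_sequence
    (g := fun m : ℕ => d * (m : ℝ) ^ 3 * Real.log 2) hα (fun n => by
      have : (0 : ℝ) ≤ Real.log (α n) := Real.log_natCast_nonneg _
      simp only [Nat.cast_zero, ne_eq, OfNat.ofNat_ne_zero, not_false_eq_true, zero_pow, mul_zero,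
        zero_mul]
      positivity)
  let P : ℕ → Prop := fun n => jumpSum a n ≤ 2 * (n + 1) * a n
  let h : ℕ → ℕ := fun n => if P n then (n + 1) * (a n ^ 3 - a n ^ 2) else a n
  let l : ℕ → ℕ := fun n => if P n then (n + 1) * a n ^ 3 else a n
  have hpow : ∀ n, a n ≤ a n ^ 2 ∧ a n ^ 2 ≤ a n ^ 3 := by
    intro n
    rcases Nat.eq_zero_or_pos (a n) with h0 | h0
    · simp [h0]
    · exact ⟨Nat.le_self_pow two_ne_zero _, Nat.pow_le_pow_right h0 (by norm_num)⟩
  have hsum : ∀ n, jumpSum a n = ∑ j ∈ Finset.range n, h j := by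
    intro n
    induction n with
    | zero => rfl
    | succ n ih => rw [Finset.sum_range_succ, ← ih]; rfl
  have hhl : ∀ n, h n ≤ l n := by
    intro n
    by_cases hP : P n
    · simp only [h, l, if_pos hP]
      exact Nat.mul_le_mul_left _ (Nat.sub_le _ _)
    · simp only [h, l, if_neg hP, le_refl]
  have hle : ∀ n, h n ≤ (n + 1) * a n ^ 3 := by
    intro n
    by_cases hP : P n
    · simp only [h, if_pos hP]
      exact Nat.mul_le_mul_left _ (Nat.sub_le _ _)
    · simp only [h, if_neg hP]
      have := hpow n
      nlinarith
  have hal : ∀ n, a n ≤ l n := by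
    intro n
    by_cases hP : P n
    · simp only [l, if_pos hP]
      have := hpow n
      nlinarith
    · simp only [l, if_neg hP, le_refl]
  have hspecial : ∀ n, P n → (l n - h n : ℝ) = (n + 1) * (a n : ℝ) ^ 2 := by
    intro n hP
    simp only [h, l, if_pos hP]
    push_cast [Nat.cast_sub (hpow n).2]
    ring
  refine ⟨h, l, ?_, hhl, tendsto_atTop_mono hal ha', ?_, ?_⟩
  · intro n
    have h1 := hlog n
    have hpos : (0 : ℝ) < α n := by exact_mod_cast hα0 n
    rw [le_div_iff₀ (by positivity), Real.le_log_iff_exp_le hpos] at h1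
    have h2 : ((2 : ℝ) ^ h n) ^ d ≤ Real.exp (d * (a n : ℝ) ^ 3 * Real.log 2 * (n + 1)) := by
      rw [← pow_mul, ← Real.rpow_natCast, Real.rpow_def_of_pos two_pos]
      refine Real.exp_le_exp.2 ?_
      have h3 : (h n : ℝ) ≤ (n + 1) * (a n : ℝ) ^ 3 := by exact_mod_cast hle n
      have h4 : (0 : ℝ) ≤ Real.log 2 := Real.log_nonneg one_le_two
      push_cast
      calc Real.log 2 * (h n * d) ≤ Real.log 2 * ((n + 1) * (a n : ℝ) ^ 3 * d) := by gcongr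
        _ = _ := by ring
    exact_mod_cast h2.trans h1
  · intro ε hε
    have hbig := (tendsto_natCast_atTop_atTop (R := ℝ)).comp ha'
    filter_upwards [hbig.eventually_ge_atTop (1 / ε)] with n hn
    by_cases hP : P n
    · rw [hspecial n hP]
      have h1 : (l n : ℝ) = (n + 1) * (a n : ℝ) ^ 3 := by
        simp only [l, if_pos hP]
        push_cast
        ring
      rw [h1]
      have h2 : 1 ≤ ε * a n := by
        rw [Function.comp_apply, div_le_iff₀ hε] at hn
        linarith
      calc (n + 1) * (a n : ℝ) ^ 2 ≤ (n + 1) * (a n : ℝ) ^ 2 * (ε * a n) :=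
            le_mul_of_one_le_right (by positivity) h2
        _ = _ := by ring
    · simp only [h, l, if_neg hP, sub_self]
      positivity
  · intro M hM
    have hbig := (tendsto_natCast_atTop_atTop (R := ℝ)).comp ha'
    refine ((frequently_jumpSum_le ha ha').and_eventually
      (hbig.eventually_ge_atTop (2 * M))).mono ?_
    rintro n ⟨hP, hn⟩
    rw [hspecial n hP]
    have h1 : ∑ j ∈ Finset.range n, (h j : ℝ) ≤ 2 * (n + 1) * a n := by
      rw [hsum n] at hP
      exact_mod_cast hP
    have hn' : 2 * M ≤ (a n : ℝ) := hn
    calc M * ∑ j ∈ Finset.range n, (h j : ℝ) ≤ M * (2 * (n + 1) * a n) := by gcongr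
      _ = 2 * M * ((n + 1) * a n) := by ring
      _ ≤ a n * ((n + 1) * a n) := by gcongr
      _ = _ := by ring

end SlowSequences

theorem eventually_exp_lt_prod {u : ℕ → ℝ} (hu : ∀ n, 0 < u n) (h : Tendsto u atTop atTop) :
    ∀ᶠ n : ℕ in atTop, Real.exp (1 * n) < ∏ j ∈ Finset.range n, u j := by
  -- Factors of at least e² leave a spare exp(n) to absorb the first N factors.
  obtain ⟨N, hN⟩ := eventually_atTop.1 (h.eventually_ge_atTop (Real.exp 2))
  set c := (∏ j ∈ Finset.range N, u j) * Real.exp (-(2 * N)) with hc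
  have hc0 : 0 < c := mul_pos (Finset.prod_pos fun j _ => hu j) (Real.exp_pos _)
  have hge : ∀ n ≥ N, c * Real.exp (2 * n) ≤ ∏ j ∈ Finset.range n, u j := by
    intro n hn
    induction n, hn using Nat.le_induction with
    | base => rw [hc, mul_assoc, ← Real.exp_add, neg_add_cancel, Real.exp_zero, mul_one]
    | succ n hn ih =>
      rw [Finset.prod_range_succ]
      calc c * Real.exp (2 * (n + 1 : ℕ)) = c * Real.exp (2 * n) * Real.exp 2 := by
            rw [Nat.cast_succ, mul_add, mul_one, Real.exp_add, ← mul_assoc]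
        _ ≤ _ := mul_le_mul ih (hN n hn) (Real.exp_pos _).le
          (Finset.prod_nonneg fun j _ => (hu j).le)
  have htend : Tendsto (fun n : ℕ => c * Real.exp n) atTop atTop :=
    (Real.tendsto_exp_atTop.comp tendsto_natCast_atTop_atTop).const_mul_atTop hc0
  filter_upwards [eventually_ge_atTop N, htend.eventually_gt_atTop 1] with n hn hn1
  refine lt_of_lt_of_le ?_ (hge n hn)
  calc Real.exp (1 * n) < c * Real.exp n * Real.exp n := by
        rw [one_mul]; exact lt_mul_of_one_lt_left (Real.exp_pos _) hn1
    _ = c * Real.exp (2 * n) := by rw [mul_assoc, ← Real.exp_add, two_mul]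

section Homothety

variable {d : ℕ} {X : Set (EuclideanSpace ℝ (Fin d))}

/-- The homothety with ratio `c`, followed by the translation by `b`. -/
def homothetyMap (c : ℝ) (b : EuclideanSpace ℝ (Fin d)) (x : EuclideanSpace ℝ (Fin d)) :
    EuclideanSpace ℝ (Fin d) := c • x + b

theorem hasFDerivAt_homothetyMap (c : ℝ) (b x : EuclideanSpace ℝ (Fin d)) :
    HasFDerivAt (homothetyMap c b) (c • ContinuousLinearMap.id ℝ (EuclideanSpace ℝ (Fin d))) x :=
  ((hasFDerivAt_id x).const_smul c).add_const b

theorem dist_homothetyMap {c : ℝ} (hc : 0 < c) (b x y : EuclideanSpace ℝ (Fin d)) :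
    dist (homothetyMap c b x) (homothetyMap c b y) = c * dist x y := by
  rw [homothetyMap, homothetyMap, dist_add_right, dist_smul₀, Real.norm_of_nonneg hc.le]

theorem hasFDerivAt_wordMap_homothetyMap {I : ℕ → Type} (c : ℕ → ℝ)
    (b : ∀ n, I n → EuclideanSpace ℝ (Fin d)) (k l : ℕ) (w : LevelWord I k l)
    (x : EuclideanSpace ℝ (Fin d)) :
    HasFDerivAt (wordMap (fun n i => homothetyMap (c n) (b n i)) k l w)
      ((∏ j ∈ Finset.range l, c (k + j)) •
        ContinuousLinearMap.id ℝ (EuclideanSpace ℝ (Fin d))) x := by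
  induction l generalizing x with
  | zero =>
    rw [Finset.prod_range_zero, one_smul]
    exact hasFDerivAt_id x
  | succ l ih =>
    have h := (ih (fun i => w i.castSucc)
      (homothetyMap (c (k + l)) (b (k + l) (w (Fin.last l))) x)).comp x
      (hasFDerivAt_homothetyMap (c (k + l)) (b (k + l) (w (Fin.last l))) x)
    rw [ContinuousLinearMap.smul_comp, ContinuousLinearMap.id_comp, smul_smul,
      ← Finset.prod_range_succ (fun j => c (k + j)) l] at h
    exact h

theorem dist_wordMap_homothetyMap {I : ℕ → Type} {c : ℕ → ℝ} (hc : ∀ n, 0 < c n)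
    (b : ∀ n, I n → EuclideanSpace ℝ (Fin d)) (k l : ℕ) (w : LevelWord I k l)
    (x y : EuclideanSpace ℝ (Fin d)) :
    dist (wordMap (fun n i => homothetyMap (c n) (b n i)) k l w x)
      (wordMap (fun n i => homothetyMap (c n) (b n i)) k l w y) =
      (∏ j ∈ Finset.range l, c (k + j)) * dist x y := by
  induction l generalizing x y with
  | zero => rw [Finset.prod_range_zero, one_mul]; rfl
  | succ l ih =>
    refine (ih (fun i => w i.castSucc) _ _).trans ?_
    rw [Finset.prod_range_succ, mul_assoc, dist_homothetyMap (hc _)]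

theorem norm_smul_id [NeZero d] {c : ℝ} (hc : 0 < c) :
    ‖c • ContinuousLinearMap.id ℝ (EuclideanSpace ℝ (Fin d))‖ = c := by
  rw [norm_smul, ContinuousLinearMap.norm_id, mul_one, Real.norm_of_nonneg hc.le]

/-- The system whose maps are homotheties, with ratios that depend only on the level. -/
def homothetySystem [NeZero d] (X : Set (EuclideanSpace ℝ (Fin d))) (I : ℕ → Type)
    [hI : ∀ n, Fintype (I n)] [hI' : ∀ n, Nonempty (I n)] (c : ℕ → ℝ)
    (b : ∀ n, I n → EuclideanSpace ℝ (Fin d)) (hc : ∀ n, 0 < c n) (hc' : ∀ n, c n ≤ 1 / 2)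
    (hX : ∀ n i, MapsTo (homothetyMap (c n) (b n i)) X X)
    (hdisj : ∀ n (i j : I n), i ≠ j →
      Disjoint (homothetyMap (c n) (b n i) '' X) (homothetyMap (c n) (b n j) '' X)) :
    NCIFS X where
  I := I
  countable_I _ := inferInstance
  nonempty_I := hI'
  map n i := homothetyMap (c n) (b n i)
  mapsTo := hX
  openSet n i j hij :=
    (hdisj n i j hij).mono (image_mono interior_subset) (image_mono interior_subset)
  V := univ
  isOpen_V := isOpen_univ
  isConnected_V := isConnected_univ
  subset_V := subset_univ X
  mapsTo_V _ _ := mapsTo_univ _ _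
  injOn_V n i x _ y _ hxy :=
    smul_right_injective _ (hc n).ne' (add_right_cancel hxy)
  contDiffOn_V n i := ((contDiff_id.const_smul (c n)).add contDiff_const).contDiffOn
  conformalAt_V n i x _ :=
    ⟨_, hasFDerivAt_homothetyMap (c n) (b n i) x, isConformalMap_const_smul (hc n).ne'⟩
  distortion := by
    refine ⟨1, le_rfl, fun k l w x _ y _ => ?_⟩
    rw [(hasFDerivAt_wordMap_homothetyMap c b k l w x).fderiv,
      (hasFDerivAt_wordMap_homothetyMap c b k l w y).fderiv, one_mul]
  contraction := by
    refine ⟨1 / 2, by norm_num, by norm_num, 0, fun m _ k w x _ => ?_⟩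
    rw [(hasFDerivAt_wordMap_homothetyMap c b k (m + 1) w x).fderiv,
      norm_smul_id (Finset.prod_pos fun j _ => hc _)]
    calc ∏ j ∈ Finset.range (m + 1), c (k + j) ≤ ∏ j ∈ Finset.range (m + 1), (1 / 2 : ℝ) :=
          Finset.prod_le_prod (fun j _ => (hc _).le) fun j _ => hc' _
      _ = (1 / 2) ^ (m + 1) := by rw [Finset.prod_const, Finset.card_range]
      _ ≤ (1 / 2) ^ m := pow_le_pow_of_le_one (by norm_num) (by norm_num) m.le_succ

end Homothety

end

/-! ### Homothetic systems on grids -/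

noncomputable section

open MeasureTheory

variable {d : ℕ} {X : Set (EuclideanSpace ℝ (Fin d))}

namespace NCIFS

/-- All the maps of the system are homotheties, and `c n` is the ratio of those of level `n`. -/
structure IsHomothetic (Φ : NCIFS X) (c : ℕ → ℝ) : Prop where
  pos : ∀ n, 0 < c n
  le_half : ∀ n, c n ≤ 1 / 2
  norm_fderiv_map : ∀ n i x, ‖fderiv ℝ (Φ.map n i) x‖ = c n
  norm_fderiv_word : ∀ n (w : Φ.Word n) x,
    ‖fderiv ℝ (Φ.word n w) x‖ = ∏ j ∈ Finset.range n, c j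
  dist_word : ∀ n (w : Φ.Word n) x y,
    dist (Φ.word n w x) (Φ.word n w y) = (∏ j ∈ Finset.range n, c j) * dist x y

theorem isHomothetic_homothetySystem [NeZero d] (I : ℕ → Type)
    [∀ n, Fintype (I n)] [∀ n, Nonempty (I n)] (c : ℕ → ℝ)
    (b : ∀ n, I n → EuclideanSpace ℝ (Fin d)) (hc : ∀ n, 0 < c n) (hc' : ∀ n, c n ≤ 1 / 2)
    (hX : ∀ n i, MapsTo (homothetyMap (c n) (b n i)) X X)
    (hdisj : ∀ n (i j : I n), i ≠ j →
      Disjoint (homothetyMap (c n) (b n i) '' X) (homothetyMap (c n) (b n j) '' X)) :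
    (homothetySystem X I c b hc hc' hX hdisj).IsHomothetic c where
  pos := hc
  le_half := hc'
  norm_fderiv_map n i x := by
    change ‖fderiv ℝ (homothetyMap (c n) (b n i)) x‖ = c n
    rw [(hasFDerivAt_homothetyMap _ _ x).fderiv, norm_smul_id (hc n)]
  norm_fderiv_word n w x := by
    refine (congrArg norm (hasFDerivAt_wordMap_homothetyMap c b 0 n w x).fderiv).trans ?_
    rw [norm_smul_id (Finset.prod_pos fun j _ => hc _)]
    simp only [zero_add]
  dist_word n w x y := by
    refine (dist_wordMap_homothetyMap hc b 0 n w x y).trans ?_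
    simp only [zero_add]

namespace IsHomothetic

variable {Φ : NCIFS X} {c : ℕ → ℝ}

theorem stronglyContracting (h : Φ.IsHomothetic c) : Φ.StronglyContracting :=
  ⟨1 / 2, by norm_num, fun n i x _ => (h.norm_fderiv_map n i x).trans_le (h.le_half n)⟩

theorem smallPieces (h : Φ.IsHomothetic c) (hc : Tendsto c atTop (𝓝 0)) : Φ.SmallPieces := by
  have hlim : Tendsto (fun n => ENNReal.ofReal (c n)) atTop (𝓝 0) := by
    rw [← ENNReal.ofReal_zero]
    exact ENNReal.tendsto_ofReal hc
  refine tendsto_of_tendsto_of_tendsto_of_le_of_le tendsto_const_nhds hlim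
    (fun n => zero_le) fun n => iSup_le fun i => iSup₂_le fun x _ => ?_
  rw [← ofReal_norm, h.norm_fderiv_map]

theorem card_word [∀ n, Fintype (Φ.I n)] (n : ℕ) :
    Fintype.card (Φ.Word n) = ∏ j ∈ Finset.range n, Nat.card (Φ.I j) := by
  rw [Fintype.card_pi, ← Fin.prod_univ_eq_prod_range (fun j => Nat.card (Φ.I j))]
  refine Finset.prod_congr rfl fun i _ => ?_
  rw [← Nat.card_eq_fintype_card, zero_add]

theorem part_eq [∀ n, Fintype (Φ.I n)] (h : Φ.IsHomothetic c) (x : EuclideanSpace ℝ (Fin d))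
    (t : ℝ) (n : ℕ) :
    Φ.part x t n = ∏ j ∈ Finset.range n, ((Nat.card (Φ.I j) : ℝ) * c j ^ t) := by
  have hwt : ∀ w : Φ.Word n, Φ.wt x n w ^ t = (∏ j ∈ Finset.range n, c j) ^ t := fun w =>
    congrArg (· ^ t) (h.norm_fderiv_word n w x)
  rw [part, Finset.sum_congr rfl fun w _ => hwt w, Finset.sum_const, Finset.card_univ,
    card_word, nsmul_eq_mul, Finset.prod_mul_distrib,
    Real.finsetProd_rpow _ _ fun j _ => (h.pos j).le]
  push_cast
  rfl

theorem lowerPressure_pos [NeZero d] [∀ n, Fintype (Φ.I n)] (h : Φ.IsHomothetic c)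
    (hX : X.Nonempty) {t : ℝ} (ht : 0 ≤ t)
    (hlim : Tendsto (fun n => (Nat.card (Φ.I n) : ℝ) * c n ^ t) atTop atTop) :
    0 < Φ.lowerPressure t := by
  obtain ⟨x, hx⟩ := hX
  by_contra hP
  refine frequently_part_le_of_lowerPressure_nonpos hx ht hP one_pos ?_
  have hpos : ∀ n, 0 < (Nat.card (Φ.I n) : ℝ) * c n ^ t := fun n => by
    have := Φ.nonempty_I n
    have h1 : (0 : ℝ) < Nat.card (Φ.I n) := by exact_mod_cast Nat.card_pos
    have := h.pos n
    positivity
  filter_upwards [eventually_exp_lt_prod hpos hlim] with n hn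
  rw [h.part_eq]
  exact not_le.2 hn

/-- All pieces of the next level are so close together that one set per word of length n covers
them. The number of sets does not involve the alphabet of level n, but their diameters are at most
`D n`. -/
theorem dimH_limitSet_eq_zero [NeZero d] [∀ n, Fintype (Φ.I n)] (h : Φ.IsHomothetic c)
    {D : ℕ → ℝ} {B : ℝ} (hD0 : ∀ n, 0 ≤ D n) (hDB : ∀ n, D n ≤ B)
    (hD : ∀ n (i j : Φ.I n), ∀ x ∈ X, ∀ y ∈ X, dist (Φ.map n i x) (Φ.map n j y) ≤ D n)
    (hfreq : ∀ s : ℝ, 0 < s → ∃ C : ℝ, ∃ᶠ n in atTop,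
      (∏ j ∈ Finset.range n, (Nat.card (Φ.I j) : ℝ)) * D n ^ s ≤ C) :
    dimH Φ.limitSet = 0 := by
  borelize (EuclideanSpace ℝ (Fin d))
  refine le_antisymm (le_of_forall_gt_imp_ge_of_dense fun a ha => ?_) zero_le
  induction a with
  | top => exact le_top
  | coe s =>
  have hs : 0 < (s : ℝ) := by exact_mod_cast ENNReal.coe_pos.1 ha
  obtain ⟨C, hC⟩ := hfreq s hs
  refine dimH_le_of_hausdorffMeasure_ne_top ?_
  let T : ∀ n, Φ.Word n → Set (EuclideanSpace ℝ (Fin d)) := fun n w =>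
    Φ.word n w '' ⋃ i : Φ.I (0 + n), Φ.map (0 + n) i '' X
  have hprod : ∀ n, ∏ j ∈ Finset.range n, c j ≤ (1 / 2) ^ n := fun n => by
    calc ∏ j ∈ Finset.range n, c j ≤ ∏ _j ∈ Finset.range n, (1 / 2 : ℝ) :=
          Finset.prod_le_prod (fun j _ => (h.pos j).le) fun j _ => h.le_half j
      _ = (1 / 2) ^ n := by rw [Finset.prod_const, Finset.card_range]
  have hdiam : ∀ n w, Metric.ediam (T n w) ≤ ENNReal.ofReal ((1 / 2) ^ n * D n) := by
    intro n w
    refine Metric.ediam_le ?_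
    rintro _ ⟨y, hy, rfl⟩ _ ⟨z, hz, rfl⟩
    obtain ⟨i, y, hyX, rfl⟩ := mem_iUnion.1 hy
    obtain ⟨j, z, hzX, rfl⟩ := mem_iUnion.1 hz
    rw [edist_dist, h.dist_word]
    have h1 := (hD (0 + n) i j y hyX z hzX).trans_eq (congrArg D (zero_add n))
    exact ENNReal.ofReal_le_ofReal (mul_le_mul (hprod n) h1 dist_nonneg (by positivity))
  have hcover : ∀ n, Φ.limitSet ⊆ ⋃ w, T n w := by
    intro n y hy
    rw [limitSet_eq_iInter] at hy
    obtain ⟨w, z, hz, rfl⟩ := mem_iUnion.1 (mem_iInter.1 hy (n + 1))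
    exact mem_iUnion.2 ⟨w.init, _, mem_iUnion.2 ⟨w (Fin.last n), mem_image_of_mem _ hz⟩, rfl⟩
  have hle := Measure.hausdorffMeasure_le_liminf_sum (s : ℝ) Φ.limitSet (l := atTop)
    (fun n => ENNReal.ofReal ((1 / 2) ^ n * B)) (by
      rw [← ENNReal.ofReal_zero]
      refine ENNReal.tendsto_ofReal ?_
      simpa using (tendsto_pow_atTop_nhds_zero_of_lt_one (r := (1 / 2 : ℝ)) (by norm_num)
        (by norm_num)).mul_const B)
    T (Eventually.of_forall fun n w => (hdiam n w).trans
      (ENNReal.ofReal_le_ofReal (by gcongr; exact hDB n)))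
    (Eventually.of_forall hcover)
  refine ((hle.trans (liminf_le_of_frequently_le' ?_)).trans_lt
    (ENNReal.ofReal_lt_top (r := C))).ne
  refine hC.mono fun n hn => ?_
  calc ∑ w, Metric.ediam (T n w) ^ (s : ℝ) ≤ ∑ _w : Φ.Word n, ENNReal.ofReal (D n ^ (s : ℝ)) := by
        refine Finset.sum_le_sum fun w _ => ?_
        rw [← ENNReal.ofReal_rpow_of_nonneg (hD0 n) s.coe_nonneg]
        gcongr
        refine (hdiam n w).trans (ENNReal.ofReal_le_ofReal ?_)
        exact mul_le_of_le_one_left (hD0 n) (pow_le_one₀ (by norm_num) (by norm_num))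
    _ = ENNReal.ofReal ((∏ j ∈ Finset.range n, (Nat.card (Φ.I j) : ℝ)) * D n ^ (s : ℝ)) := by
        rw [Finset.sum_const, Finset.card_univ, card_word, nsmul_eq_mul,
          ENNReal.ofReal_mul (by positivity), ← Nat.cast_prod, ENNReal.ofReal_natCast]
    _ ≤ ENNReal.ofReal C := ENNReal.ofReal_le_ofReal hn

end IsHomothetic

end NCIFS

/-- The point of the integer grid with given coordinates. -/
def gridPoint {q : ℕ} (z : Fin d → Fin q) : EuclideanSpace ℝ (Fin d) :=
  WithLp.toLp 2 fun i => ((z i : ℕ) : ℝ)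

theorem norm_gridPoint_le {q : ℕ} (z : Fin d → Fin q) : ‖gridPoint z‖ ≤ d * q := by
  rw [EuclideanSpace.norm_eq]
  refine Real.sqrt_le_iff.2 ⟨by positivity, ?_⟩
  calc ∑ i, ‖gridPoint z i‖ ^ 2 ≤ ∑ _i : Fin d, (q : ℝ) ^ 2 := by
        refine Finset.sum_le_sum fun i _ => ?_
        rw [gridPoint, Real.norm_natCast]
        gcongr
        exact (z i).2.le
    _ = d * (q : ℝ) ^ 2 := by
        rw [Finset.sum_const, Finset.card_univ, Fintype.card_fin, nsmul_eq_mul]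
    _ ≤ (d : ℝ) ^ 2 * (q : ℝ) ^ 2 := by
        gcongr
        exact_mod_cast Nat.le_self_pow two_ne_zero d
    _ = (d * q) ^ 2 := (mul_pow _ _ _).symm

/-- Copies of `X` scaled by c are centred at grid points of spacing 3Dc around an interior point p.
Each copy has radius at most Dc, so they are disjoint whatever the shape of `X`. -/
theorem exists_grid_system [NeZero d] (hX : IsPhaseSpace X) :
    ∃ c₀ B : ℝ, 0 < c₀ ∧ 0 < B ∧ ∀ h l : ℕ → ℕ, (∀ n, h n ≤ l n) →
      ∃ Φ : NCIFS X, Φ.IsHomothetic (fun n => c₀ * (1 / 2) ^ l n) ∧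
        (∀ n, Finite (Φ.I n) ∧ Nat.card (Φ.I n) = (2 ^ h n) ^ d) ∧
        ∀ n (i j : Φ.I n), ∀ x ∈ X, ∀ y ∈ X,
          dist (Φ.map n i x) (Φ.map n j y) ≤ B * (2 ^ h n * (1 / 2) ^ l n) := by
  obtain ⟨p, hp⟩ := hX.interior_nonempty
  obtain ⟨r, hr, hball⟩ := Metric.isOpen_iff.1 isOpen_interior p hp
  obtain ⟨D, hD0, hD⟩ := hX.isCompact.isBounded.subset_closedBall_lt 0 p
  have hd0 : (0 : ℝ) < d := by exact_mod_cast Nat.pos_of_neZero d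
  -- Small enough that the whole grid lies in the ball of radius r around p, which is inside `X`,
  -- whenever h ≤ l.
  set c₀ : ℝ := min (1 / 2) (r / (2 * (D * (1 + 3 * d)))) with hc₀
  have hc0 : 0 < c₀ := by positivity
  have hcr : c₀ * (D * (1 + 3 * d)) < r := by
    have h1 : c₀ ≤ r / (2 * (D * (1 + 3 * d))) := min_le_right _ _
    rw [le_div_iff₀ (by positivity)] at h1
    linarith
  refine ⟨c₀, 2 * r, hc0, by positivity, fun h l hhl => ?_⟩
  set c : ℕ → ℝ := fun n => c₀ * (1 / 2) ^ l n with hc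
  have hcpos : ∀ n, 0 < c n := fun n => by positivity
  have hchalf : ∀ n, c n ≤ 1 / 2 := fun n =>
    (mul_le_of_le_one_right hc0.le (pow_le_one₀ (by norm_num) (by norm_num))).trans
      (min_le_left _ _)
  let b : ∀ n, (Fin d → Fin (2 ^ h n)) → EuclideanSpace ℝ (Fin d) := fun n z =>
    (p - c n • p) + (3 * D * c n) • gridPoint z
  have hdist : ∀ n z, ∀ x ∈ X, dist (homothetyMap (c n) (b n z) x) p ≤
      c₀ * (D * (1 + 3 * d)) * (2 ^ h n * (1 / 2) ^ l n) := by
    intro n z x hx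
    have h1 : homothetyMap (c n) (b n z) x - p = c n • (x - p) + (3 * D * c n) • gridPoint z := by
      simp only [homothetyMap, b]
      module
    have hcn := hcpos n
    have h2 : ‖x - p‖ ≤ D := by
      rw [← dist_eq_norm]; exact hD hx
    have h3 : (1 : ℝ) ≤ 2 ^ h n := one_le_pow₀ one_le_two
    have h4 := norm_gridPoint_le z
    push_cast at h4
    rw [dist_eq_norm, h1]
    calc ‖c n • (x - p) + (3 * D * c n) • gridPoint z‖
        ≤ c n * ‖x - p‖ + 3 * D * c n * ‖gridPoint z‖ := by
          refine (norm_add_le _ _).trans_eq ?_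
          rw [norm_smul, norm_smul, Real.norm_of_nonneg hcn.le,
            Real.norm_of_nonneg (by positivity)]
      _ ≤ c n * (D * 2 ^ h n) + 3 * D * c n * (d * 2 ^ h n) := by
          gcongr
          exact h2.trans (le_mul_of_one_le_right hD0.le h3)
      _ = _ := by rw [hc]; ring
  have hfrac : ∀ n, (2 : ℝ) ^ h n * (1 / 2) ^ l n ≤ 1 := by
    intro n
    calc (2 : ℝ) ^ h n * (1 / 2) ^ l n ≤ 2 ^ l n * (1 / 2) ^ l n := by
          gcongr
          · exact one_le_two
          · exact hhl n
      _ = 1 := by rw [← mul_pow]; norm_num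
  have hmaps : ∀ n z, MapsTo (homothetyMap (c n) (b n z)) X X := by
    intro n z x hx
    refine interior_subset (hball (Metric.mem_ball.2 ((hdist n z x hx).trans_lt ?_)))
    exact (mul_le_of_le_one_right (by positivity) (hfrac n)).trans_lt hcr
  have hdisj : ∀ n (z z' : Fin d → Fin (2 ^ h n)), z ≠ z' →
      Disjoint (homothetyMap (c n) (b n z) '' X) (homothetyMap (c n) (b n z') '' X) := by
    intro n z z' hz
    rw [Set.disjoint_left]
    rintro _ ⟨x, hx, rfl⟩ ⟨y, hy, hxy⟩
    obtain ⟨i, hi⟩ := Function.ne_iff.1 hz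
    have hcn := hcpos n
    have h1 : y - x = (3 * D) • (gridPoint z - gridPoint z') := by
      have h2 : c n • (y - x) = c n • ((3 * D) • (gridPoint z - gridPoint z')) := by
        have h3 : homothetyMap (c n) (b n z') y - homothetyMap (c n) (b n z) x = 0 :=
          sub_eq_zero.2 hxy
        rw [← sub_eq_zero, ← h3]
        simp only [homothetyMap, b]
        module
      exact smul_right_injective _ hcn.ne' h2
    have h4 : ‖y - x‖ ≤ 2 * D := by
      rw [← dist_eq_norm]
      have h5 : dist y p ≤ D := hD hy
      have h6 : dist x p ≤ D := hD hx
      linarith [dist_triangle_right y x p]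
    -- Distinct grid points differ by at least 1 in some coordinate, so a common image would force x
    -- and y to be too far apart.
    have h7 : 3 * D ≤ ‖y - x‖ := by
      refine le_trans ?_ (PiLp.norm_apply_le (y - x) i)
      rw [h1, PiLp.smul_apply, PiLp.sub_apply, norm_smul, Real.norm_of_nonneg (by positivity)]
      refine le_mul_of_one_le_right (by positivity) ?_
      simp only [gridPoint]
      have h8 : ((z i : ℕ) : ℤ) - (z' i : ℕ) ≠ 0 := by
        intro h9
        apply hi
        ext
        omega
      have h10 := Int.one_le_abs h8
      rw [Real.norm_eq_abs]
      exact_mod_cast h10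
    linarith
  refine ⟨homothetySystem X (fun n => Fin d → Fin (2 ^ h n)) c b hcpos hchalf hmaps hdisj,
    NCIFS.isHomothetic_homothetySystem _ c b hcpos hchalf hmaps hdisj, ?_, ?_⟩
  · intro n
    change Finite (Fin d → Fin (2 ^ h n)) ∧ Nat.card (Fin d → Fin (2 ^ h n)) = _
    exact ⟨inferInstance, by simp⟩
  · intro n z z' x hx y hy
    change dist (homothetyMap (c n) (b n z) x) (homothetyMap (c n) (b n z') y) ≤ _
    have h1 := hdist n z x hx
    have h2 := hdist n z' y hy
    have h3 : c₀ * (D * (1 + 3 * d)) * (2 ^ h n * (1 / 2) ^ l n) ≤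
        r * (2 ^ h n * (1 / 2) ^ l n) := by gcongr
    linarith [dist_triangle_right (homothetyMap (c n) (b n z) x)
      (homothetyMap (c n) (b n z') y) p]

theorem exists_system_of_jump_sequences [NeZero d] (hX : IsPhaseSpace X) {h l : ℕ → ℕ}
    (hhl : ∀ n, h n ≤ l n) (hl : Tendsto l atTop atTop)
    (hsmall : ∀ ε : ℝ, 0 < ε → ∀ᶠ n in atTop, (l n - h n : ℝ) ≤ ε * l n)
    (hjump : ∀ M : ℝ, 0 ≤ M →
      ∃ᶠ n in atTop, M * ∑ j ∈ Finset.range n, (h j : ℝ) ≤ l n - h n) :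
    ∃ Φ : NCIFS X, (∀ n, Finite (Φ.I n) ∧ Nat.card (Φ.I n) = (2 ^ h n) ^ d) ∧
      Φ.StronglyContracting ∧ Φ.SmallPieces ∧ dimH Φ.limitSet = 0 ∧
        Φ.bowenDim = (d : ℝ≥0∞) := by
  have hd0 : (0 : ℝ) < d := by exact_mod_cast Nat.pos_of_neZero d
  obtain ⟨c₀, B, hc₀, hB, hsys⟩ := exists_grid_system hX
  obtain ⟨Φ, hΦ, hcard, hdist⟩ := hsys h l hhl
  have hfin : ∀ n, Finite (Φ.I n) := fun n => (hcard n).1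
  let hft : ∀ n, Fintype (Φ.I n) := fun n => Fintype.ofFinite _
  have hlR : Tendsto (fun n => (l n : ℝ)) atTop atTop := tendsto_natCast_atTop_atTop.comp hl
  have hcardR : ∀ n, (Nat.card (Φ.I n) : ℝ) = (2 : ℝ) ^ (d * h n : ℝ) := fun n => by
    rw [(hcard n).2, ← Nat.cast_mul, Real.rpow_natCast]
    push_cast
    rw [← pow_mul, mul_comm]
  refine ⟨Φ, hcard, hΦ.stronglyContracting, hΦ.smallPieces ?_, ?_, ?_⟩
  · simpa using ((tendsto_pow_atTop_nhds_zero_of_lt_one (r := (1 / 2 : ℝ)) (by norm_num)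
      (by norm_num)).comp hl).const_mul c₀
  · have hDeq : ∀ n, (2 : ℝ) ^ h n * (1 / 2) ^ l n = (2 : ℝ) ^ (-(l n - h n : ℝ)) := fun n => by
      rw [neg_sub, Real.rpow_sub two_pos, Real.rpow_natCast, Real.rpow_natCast, one_div, inv_pow,
        div_eq_mul_inv]
    refine hΦ.dimH_limitSet_eq_zero (D := fun n => B * (2 ^ h n * (1 / 2) ^ l n)) (B := B)
      (fun n => by positivity) (fun n => mul_le_of_le_one_right hB.le ?_) hdist ?_
    · rw [hDeq]
      have h1 : (h n : ℝ) ≤ l n := by exact_mod_cast hhl n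
      exact Real.rpow_le_one_of_one_le_of_nonpos one_le_two (by linarith)
    · intro s hs
      -- With M = d/s, the 2^(d Σ h) covering sets are compensated by the factor 2^(-s(l - h)).
      refine ⟨B ^ s, (hjump (d / s) (by positivity)).mono fun n hn => ?_⟩
      rw [Finset.prod_congr rfl fun j _ => hcardR j, ← Real.rpow_sum_of_pos two_pos,
        ← Finset.mul_sum, hDeq, Real.mul_rpow hB.le (by positivity), ← Real.rpow_mul two_pos.le,
        mul_left_comm, ← Real.rpow_add two_pos]
      refine mul_le_of_le_one_right (by positivity)
        (Real.rpow_le_one_of_one_le_of_nonpos one_le_two ?_)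
      rw [div_mul_eq_mul_div, div_le_iff₀ hs] at hn
      linarith
  · refine le_antisymm (NCIFS.bowenDim_le hX) (le_of_forall_lt_imp_le_of_dense fun a ha => ?_)
    lift a to ℝ≥0 using ha.ne_top
    have had : (a : ℝ) < d := by exact_mod_cast ha
    refine le_iSup₂ (f := fun (s : ℝ≥0) (_ : 0 < Φ.lowerPressure s) => (s : ℝ≥0∞)) a ?_
    refine hΦ.lowerPressure_pos hX.nonempty a.2 ?_
    -- Half of d - a absorbs the loss d(l - h); the other half makes the terms grow like 2^(e l).
    set e : ℝ := (d - a) / 2 with he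
    have he0 : 0 < e := by rw [he]; linarith
    have hlow : Tendsto (fun n => c₀ ^ (a : ℝ) * (2 : ℝ) ^ (e * l n)) atTop atTop :=
      ((tendsto_rpow_atTop_of_base_gt_one 2 one_lt_two).comp
        (hlR.const_mul_atTop he0)).const_mul_atTop (by positivity)
    refine tendsto_atTop_mono' _ ?_ hlow
    filter_upwards [hsmall (e / d) (by positivity)] with n hn
    have h1 : (c₀ * (1 / 2) ^ l n) ^ (a : ℝ) = c₀ ^ (a : ℝ) * (2 : ℝ) ^ (-(a * l n) : ℝ) := by
      rw [Real.mul_rpow hc₀.le (by positivity), one_div, inv_pow, Real.inv_rpow (by positivity),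
        ← Real.rpow_natCast, ← Real.rpow_mul two_pos.le, ← Real.rpow_neg two_pos.le]
      congr 3
      ring
    rw [hcardR, h1, mul_left_comm, ← Real.rpow_add two_pos]
    gcongr
    · exact one_le_two
    · rw [div_mul_eq_mul_div, le_div_iff₀ hd0] at hn
      have h2 : e * l n = (d - a) * l n - e * l n := by rw [he]; ring
      linarith

end

theorem theorem1p2 (d : ℕ) (hd : 1 ≤ d) (X : Set (EuclideanSpace ℝ (Fin d)))
    (hX : IsPhaseSpace X) :
    (∀ Φ : NCIFS X, (∀ n, Finite (Φ.I n)) →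
      limsup (fun n : ℕ => ((Real.log (Nat.card (Φ.I n)) / (n + 1) : ℝ) : EReal)) atTop < ⊤ →
      (Φ.SmallPieces ∨ dimH Φ.limitSet = 0 ∨ Φ.bowenDim = (d : ℝ≥0∞)) →
      Φ.BowenFormula) ∧
    (∀ α : ℕ → ℕ, (∀ n, 0 < α n) →
      Tendsto (fun n : ℕ => Real.log (α n) / (n + 1)) atTop atTop →
      ∃ Φ : NCIFS X, (∀ n, Finite (Φ.I n) ∧ Nat.card (Φ.I n) ≤ α n) ∧
        Φ.StronglyContracting ∧
        Φ.SmallPieces ∧ dimH Φ.limitSet = 0 ∧ Φ.bowenDim = (d : ℝ≥0∞) ∧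
        ¬ Φ.BowenFormula) := by
  have : NeZero d := ⟨by omega⟩
  refine ⟨fun Φ hfin hgrowth hΦ => ?_, fun α hα0 hα => ?_⟩
  · have := fun n => Fintype.ofFinite (Φ.I n)
    exact NCIFS.bowenFormula_of_exponential_growth hX hgrowth hΦ
  · obtain ⟨h, l, hα', hhl, hl, hsmall, hjump⟩ := exists_jump_sequences d hα0 hα
    obtain ⟨Φ, hcard, hΦ⟩ := exists_system_of_jump_sequences hX hhl hl hsmall hjump
    refine ⟨Φ, fun n => ⟨(hcard n).1, (hcard n).2.trans_le (hα' n)⟩, hΦ.1, hΦ.2.1, hΦ.2.2.1,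
      hΦ.2.2.2, fun hB => ?_⟩
    rw [NCIFS.BowenFormula, hΦ.2.2.1, hΦ.2.2.2] at hB
    exact NeZero.ne d (by exact_mod_cast hB.symm)
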